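/- **Model.** In the synchronous message-passing model on an $n$-vertex graph $G=(V,E)$, every vertex has a unique identity number in $\{1,\dots,n\}$ and initially knows only this number and the arguments of the procedure; in every round each vertex may send a message to each of its neighbours. The running time is the number of rounds until every vertex has given its (irrevocable) answer. The arboricity $a(G)$ is the least number of edge-disjoint forests that cover $E$; an $r$-arbdefective $k$-coloring is a coloring with colors $1,\dots,k$ in which every color class induces a subgraph of arboricity at most $r$. Logarithms are to base 2, and $0<\epsilon<1/2$ is a fixed constant. **Procedure Arbdefective-Coloring$(H,k,t)$**, on a graph $H$ with a bound $\alpha$ for its arboricity, computes: (i) a partition of $V(H)$ into $H_1,\dots,H_\ell$, $\ell=O(\log n)$, such that every $v\in H_i$ has at most $\lfloor(2+\epsilon)\alpha\rfloor$ neighbours in $\bigcup_{j\ge i}H_j$; (ii) for every $i$ a coloring of the subgraph induced by $H_i$ with $O(t^2)$ colors in which every vertex has at most $\lfloor\alpha/t\rfloor$ neighbours of its own color; (iii) the partial orientation in which an edge between different sets $H_i$, $H_j$ is oriented towards the set of greater index, an edge inside one $H_i$ towards the endpoint of greater color, and not at all if the two colors agree; (iv) a $k$-coloring in which every vertex has a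 color from $\{1,\dots,k\}$ that is used by the minimum number of its out-neighbours (parents). **Procedure Legal-Coloring$(G,p)$** starts with the collection $\{G\}$ and $\alpha:=a(G)$. While $\alpha>p$, it applies Arbdefective-Coloring with $k=t=p$ to every graph of the collection in parallel, replaces the $i$-th graph by its $p$ subgraphs induced by the colors $j=1,\dots,p$, with indices $(i-1)p+j$, and sets $\alpha:=\lfloor \alpha/p+(2+\epsilon)\alpha/p\rfloor$. Finally, with $A:=\lfloor(2+\epsilon)\alpha\rfloor+1$, it colors the $i$-th graph of the collection legally with the palette $\{(i-1)A+1,\dots,iA\}$. If $p<16$, the loop is skipped. **Theorem.** Fix $0<\epsilon<1/2$. Procedure Legal-Coloring has a deterministic implementation in the synchronous message-passing model (one algorithm with arguments $a$ and $p$, and one constant for the $O(\log n)$ and $O(t^2)$ in (i) and (ii), all depending only on $\epsilon$) such that for every constant $0<\mu<1$ there is a constant $C=C(\mu,\epsilon)$ with the following property. Let $G$ be a graph with $n$ vertices and arboricity $a\ge 1$, with any assignment of identities, and let $p=\lceil a^{\mu/2}\rceil$. Then the loop of Procedure Legal-Coloring$(G,p)$ has at most $C$ iterations; in every run of the procedure,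 each application of Arbdefective-Coloring to a graph of the collection yields a $\lfloor \alpha/p+(2+\epsilon)\alpha/p\rfloor$-arbdefective $p$-coloring of it ($\alpha$ being the value before the iteration), and the final coloring is a legal coloring of $G$ with colors from $\{1,\dots,\lfloor C a\rfloor\}$; and the implementation carries out a run of the procedure within $C\,a^{\mu}\log n$ rounds. In short: Procedure Legal-Coloring with $p=\lceil a^{\mu/2}\rceil$ computes a legal $O(a)$-coloring in $O(a^{\mu}\log n)$ time. -/

import Mathlib

universe u

namespace LegalColoring

/-! ## The synchronous message-passing model -/

/-- A deterministic algorithm of the synchronous message-passing model. Every vertex runs the same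
program. At the beginning a vertex knows the arguments of the procedure and its own identity number,
and nothing else (in particular neither the graph, nor its degree, nor the number of vertices). In a
round it sends one message to each neighbour (`send s j` is the message of a vertex in state `s` for
its neighbour of identity `j`) and then updates its state from the messages received in this round,
indexed by the identity of the sender. Messages and local computation are not bounded. `output`
is the answer of the vertex once it has one. -/
structure LocalAlgorithm (Arg Out : Type) where
  State : Type
  Msg : Type
  init : Arg → ℕ → State
  send : State → ℕ → Msg
  receive : State → (ℕ → Option Msg) → State
  output : State → Option Out

namespace LocalAlgorithm

variable {Arg Out : Type} (A : LocalAlgorithm Arg Out)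

open Classical in
/-- The messages that `v` receives in a round that starts in the configuration `s`: the value at `j`
is the message of the neighbour of identity `j`, and `none` if there is no such neighbour. -/
noncomputable def inbox {V : Type u} (G : SimpleGraph V) (ident : V → ℕ) (s : V → A.State) (v : V) :
    ℕ → Option A.Msg :=
  fun j => if h : ∃ w, G.Adj v w ∧ ident w = j then some (A.send (s h.choose) (ident v)) else none

/-- The configuration (state of every vertex) after a given number of rounds. -/
noncomputable def config {V : Type u} (G : SimpleGraph V) (ident : V → ℕ) (x : Arg) :
    ℕ → V → A.State
  | 0 => fun v => A.init x (ident v)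
  | r + 1 => fun v =>
      A.receive (config G ident x r v) (A.inbox G ident (config G ident x r) v)

/-- On the network `G` with identities `ident` and argument `x`, every vertex `v` gives the answer
`o v`, after at most `T` rounds. Answers are irrevocable: no vertex ever shows another answer. -/
def ComputesWithin {V : Type u} (G : SimpleGraph V) (ident : V → ℕ) (x : Arg) (T : ℕ)
    (o : V → Out) : Prop :=
  (∀ v r, T ≤ r → A.output (A.config G ident x r v) = some (o v)) ∧
    ∀ v r y, A.output (A.config G ident x r v) = some y → y = o v

end LocalAlgorithm

/-! ## Colorings and arboricity -/

/-- The edge set of `G` is the disjoint union of the edge sets of `k` forests. -/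
def HasForestsDecomposition {V : Type u} (G : SimpleGraph V) (k : ℕ) : Prop :=
  ∃ F : Fin k → SimpleGraph V,
    (∀ i, (F i).IsAcyclic) ∧ (∀ i j, i ≠ j → Disjoint (F i) (F j)) ∧ ⨆ i, F i = G

/-- The arboricity: the least number of edge-disjoint forests that cover the edges. -/
noncomputable def arboricity {V : Type u} (G : SimpleGraph V) : ℕ :=
  sInf {k | HasForestsDecomposition G k}

def IsLegalColoring {V : Type u} (G : SimpleGraph V) (φ : V → ℕ) : Prop :=
  ∀ v w, G.Adj v w → φ v ≠ φ w

/-- The subgraph of `G` induced by the vertices of color `i`. -/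
abbrev colorClass {V : Type u} (G : SimpleGraph V) (φ : V → ℕ) (i : ℕ) :
    SimpleGraph {v | φ v = i} :=
  G.induce {v | φ v = i}

/-- `φ` is an `m`-defective coloring with colors `1, 2, …, ⌊q⌋`. -/
def IsDefectiveColoring {V : Type u} (G : SimpleGraph V) (φ : V → ℕ) (m : ℕ) (q : ℝ) : Prop :=
  (∀ v, 1 ≤ φ v ∧ (φ v : ℝ) ≤ q) ∧ ∀ v, {w | G.Adj v w ∧ φ w = φ v}.ncard ≤ m

/-- `φ` is an `r`-arbdefective `k`-coloring. -/
def IsArbdefectiveColoring {V : Type u} (G : SimpleGraph V) (φ : V → ℕ) (r k : ℕ) : Prop :=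
  (∀ v, 1 ≤ φ v ∧ φ v ≤ k) ∧ ∀ i, 1 ≤ i → i ≤ k → arboricity (colorClass G φ i) ≤ r

/-! ## The procedures

The procedures leave some choices open (which `H`-partition, which defective coloring, which of
several least used colors). They are described by the relation between their input and the
results that they may produce. -/

/-- `h` is the index function of an `H`-partition `H₁, …, H_ℓ`, `ℓ ≤ L`, of degree at most `D`. -/
def IsHPartition {V : Type u} (G : SimpleGraph V) (h : V → ℕ) (L : ℝ) (D : ℕ) : Prop :=
  (∀ v, 1 ≤ h v ∧ (h v : ℝ) ≤ L) ∧ ∀ v, {w | G.Adj v w ∧ h v ≤ h w}.ncard ≤ D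

/-- The partial orientation given by an `H`-partition `h` and a coloring `d`: an edge is oriented
towards the greater `H`-index, and inside an `H`-set towards the greater color (it stays unoriented
if the colors agree). `IsParent G h d v w` says that the edge `vw` is oriented towards `w`. -/
def IsParent {V : Type u} (G : SimpleGraph V) (h d : V → ℕ) (v w : V) : Prop :=
  G.Adj v w ∧ (h v < h w ∨ (h v = h w ∧ d v < d w))

/-- Procedure Partial-Orientation on a graph with (upper bound for the) arboricity `α` and
parameter `t`: an `H`-partition `h` of degree at most `⌊(2 + ε) α⌋` with at most `K log n` sets, and
a `⌊α / t⌋`-defective coloring `d` with at most `K t ^ 2` colors of the subgraph induced by every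
`H`-set. -/
def IsPartialOrientationRun {V : Type u} (ε K : ℝ) (n : ℕ) (G : SimpleGraph V) (α t : ℕ)
    (h d : V → ℕ) : Prop :=
  IsHPartition G h (K * Real.logb 2 n) ⌊(2 + ε) * α⌋₊ ∧
    ∀ i, IsDefectiveColoring (colorClass G h i) (fun v => d v) (α / t) (K * (t : ℝ) ^ 2)

/-- Procedure Simple-Arbdefective with parameter `k`, on the orientation given by `h` and `d`: every
vertex selects a color of `{1, …, k}` that is used by the minimum number of its parents. -/
def IsSimpleArbdefectiveRun {V : Type u} (G : SimpleGraph V) (h d : V → ℕ) (k : ℕ)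
    (c : V → ℕ) : Prop :=
  ∀ v, (1 ≤ c v ∧ c v ≤ k) ∧ ∀ j, 1 ≤ j → j ≤ k →
    {w | IsParent G h d v w ∧ c w = c v}.ncard ≤ {w | IsParent G h d v w ∧ c w = j}.ncard

/-- Procedure Arbdefective-Coloring(`G`, `k`, `t`): Partial-Orientation, then
Simple-Arbdefective. -/
def IsArbdefectiveColoringRun {V : Type u} (ε K : ℝ) (n : ℕ) (G : SimpleGraph V) (α k t : ℕ)
    (h d c : V → ℕ) : Prop :=
  IsPartialOrientationRun ε K n G α t h d ∧ IsSimpleArbdefectiveRun G h d k c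

/-- The value of the variable `α` of Procedure Legal-Coloring after `i` iterations of its loop. -/
noncomputable def alpha (ε : ℝ) (a p : ℕ) : ℕ → ℕ
  | 0 => a
  | i + 1 => ⌊(alpha ε a p i : ℝ) / p + (2 + ε) * (alpha ε a p i : ℝ) / p⌋₊

/-- `m` is the number of iterations of the loop `while α > p`. For `p < 16`, where `α` need not
decrease, the loop is skipped and the graph is colored directly. -/
def IsLoopLength (ε : ℝ) (a p m : ℕ) : Prop :=
  (16 ≤ p → (∀ i, i < m → p < alpha ε a p i) ∧ alpha ε a p m ≤ p) ∧ (p < 16 → m = 0)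

/-- What a vertex has computed: in the iteration `i + 1` of the loop its `H`-index, its color in the
defective coloring, and its color in the arbdefective coloring; and its final color. -/
structure VertexRecord where
  hIndex : ℕ → ℕ
  defColor : ℕ → ℕ
  arbColor : ℕ → ℕ
  color : ℕ

/-- The index of the subgraph to which a vertex belongs after `i` iterations. -/
def partIndex (p : ℕ) (x : VertexRecord) : ℕ → ℕ
  | 0 => 1
  | i + 1 => (partIndex p x i - 1) * p + x.arbColor i

/-- The results `ρ` of the vertices form a run of Procedure Legal-Coloring(`G`, `p`) with `m`
iterations of the loop: in every iteration Procedure Arbdefective-Coloring with `k = t = p` is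
carried out on every subgraph of the current collection, and in the end the subgraph of index `g` is
colored legally from the palette `{(g - 1) A + 1, …, g A}`, where `A = ⌊(2 + ε) α⌋ + 1`. -/
def IsLegalColoringRun {V : Type u} [Fintype V] (ε K : ℝ) (G : SimpleGraph V) (p m : ℕ)
    (ρ : V → VertexRecord) : Prop :=
  (∀ i, i < m → ∀ g,
    IsArbdefectiveColoringRun ε K (Fintype.card V)
      (colorClass G (fun v => partIndex p (ρ v) i) g) (alpha ε (arboricity G) p i) p p
      (fun v => (ρ v).hIndex i) (fun v => (ρ v).defColor i) (fun v => (ρ v).arbColor i)) ∧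
  ∀ g,
    IsLegalColoring (colorClass G (fun v => partIndex p (ρ v) m) g) (fun v => (ρ v).color) ∧
    ∀ v, partIndex p (ρ v) m = g →
      (g - 1) * (⌊(2 + ε) * (alpha ε (arboricity G) p m : ℝ)⌋₊ + 1) + 1 ≤ (ρ v).color ∧
      (ρ v).color ≤ g * (⌊(2 + ε) * (alpha ε (arboricity G) p m : ℝ)⌋₊ + 1)

end LegalColoring

/-! Correctness. Ordering vertices lexicographically by `H`-index, defective colour and identity
completes the partial orientation to an acyclic one. A vertex has at most `⌊(2 + ε) α⌋` parents, so
its least used colour occurs on at most a `1/p` fraction of that many; neighbours left unoriented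
number at most `α / p`. Every new class thus has an acyclic orientation of out-degree at most the
next `α`, which bounds its arboricity (`IsParallelRun.ncard_greater_le`, `arboricity_le_of_rank`).
For `p ≥ 16` an iteration divides `α` by at least `√p ≥ a ^ (μ / 4)`, so about `4 / μ` iterations
suffice (`alpha_le_of_le`). Since `α` loses only a factor `3.5` against `1 / p` each time, the
number of classes times the final palette stays `O(a)` (`pow_mul_palette_le`).

Implementation. Vertices do not know `n`, so they cannot tell when a phase is over. The algorithm is
therefore a system of defining rules without a clock: a vertex forwards all it knows and fixes a
variable once every completion of its knowledge gives the same value. Values never change, and the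
running time is the round by which the needed variables are known (`LocalRules.known_succ`,
`LocalRules.computesWithin`).

The `H`-partition peels off vertices of low remaining degree; a fraction `2 / (2 + ε)` at most
survives each step, whence `O(log n)` sets. The defective colouring descends through levels,
recolouring by evaluating quadratic polynomials over prime fields; the defects added form a
geometric series (`level_defect`). The least-used colours are then selected along the orientation,
whose paths have length `O(p ^ 2 log n)` with `p ^ 2 = O(a ^ μ)` (`known_color`). The final legal
colouring is one more iteration with defect `0` and more colours than parents
(`IsParallelRun.color_ne`). -/

namespace LegalColoring

/-! ### Values at the neighbours of a vertex -/

open Classical in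
/-- The values of `f` at the neighbours of `v`, indexed by their identities. -/
noncomputable def neighborTable {V : Type u} {β : Type} (G : SimpleGraph V) (ident : V → ℕ)
    (f : V → β) (v : V) : ℕ → Option β :=
  fun j => if h : ∃ w, G.Adj v w ∧ ident w = j then some (f h.choose) else none

lemma neighborTable_eq_some_iff {V : Type u} {β : Type} {G : SimpleGraph V} {ident : V → ℕ}
    (hid : Function.Injective ident) {f : V → β} {v : V} {j : ℕ} {t : β} :
    neighborTable G ident f v j = some t ↔ ∃ w, G.Adj v w ∧ ident w = j ∧ f w = t := by
  unfold neighborTable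
  split_ifs with h
  · have hw := h.choose_spec
    constructor
    · intro e
      exact ⟨h.choose, hw.1, hw.2, Option.some.inj e⟩
    · rintro ⟨w, h1, h2, h3⟩
      have : h.choose = w := hid (hw.2.trans h2.symm)
      rw [this, h3]
  · constructor
    · intro e; cases e
    · rintro ⟨w, h1, h2, -⟩
      exact absurd ⟨w, h1, h2⟩ h

lemma ncard_neighborTable {V : Type u} {β : Type} {G : SimpleGraph V} {ident : V → ℕ}
    (hid : Function.Injective ident) (f : V → β) (v : V) (Q : β → Prop) :
    {j | ∃ t, neighborTable G ident f v j = some t ∧ Q t}.ncard =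
      {w | G.Adj v w ∧ Q (f w)}.ncard := by
  have : {j | ∃ t, neighborTable G ident f v j = some t ∧ Q t} =
      ident '' {w | G.Adj v w ∧ Q (f w)} := by
    ext j
    simp only [neighborTable_eq_some_iff hid, Set.mem_ofPred_eq, Set.mem_image]
    constructor
    · rintro ⟨t, ⟨w, h1, h2, rfl⟩, h3⟩
      exact ⟨w, ⟨h1, h3⟩, h2⟩
    · rintro ⟨w, ⟨h1, h3⟩, h2⟩
      exact ⟨_, ⟨w, h1, h2, rfl⟩, h3⟩
  rw [this, Set.ncard_image_of_injective _ hid]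

/-! ## Algorithms given by local rules -/

/-- A local algorithm described by variables indexed by `κ`: `value` is the rule that determines the
value of a variable of a vertex from the argument, the identity of the vertex, its own variables,
and those of its neighbours; `answer` is its answer in terms of its variables. -/
structure LocalRules (Arg κ Out : Type) where
  value : Arg → ℕ → (κ → ℕ) → (ℕ → Option (κ → ℕ)) → κ → ℕ
  answer : Arg → (κ → ℕ) → Out

/-- The complete table `f` is compatible with the partial table `s`. -/
def Extends {κ : Type} (f : κ → ℕ) (s : κ → Option ℕ) : Prop :=
  ∀ k y, s k = some y → f k = y

/-- The complete tables `N` of the neighbours are compatible with their partial tables `M`. -/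
def ExtendsInbox {κ : Type} (N : ℕ → Option (κ → ℕ)) (M : ℕ → Option (κ → Option ℕ)) : Prop :=
  ∀ j, (M j = none → N j = none) ∧ ∀ s, M j = some s → ∃ f, N j = some f ∧ Extends f s

open Classical in
/-- The common value of `F` on `S`, if there is one. -/
noncomputable def commonValue {ι β : Type} (S : Set ι) (F : ι → β) : Option β :=
  if h : ∃ y, ∀ x ∈ S, F x = y then some h.choose else none

lemma eq_of_commonValue {ι β : Type} {S : Set ι} {F : ι → β} {y : β} {x : ι}
    (h : commonValue S F = some y) (hx : x ∈ S) : F x = y := by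
  unfold commonValue at h
  split_ifs at h with h'
  rw [← Option.some.inj h]
  exact h'.choose_spec x hx

/-- Nonemptiness makes the common value unique; on the empty set every value would be common. -/
lemma commonValue_eq_some {ι β : Type} {S : Set ι} {F : ι → β} {y : β}
    (h : ∀ x ∈ S, F x = y) (hS : S.Nonempty) : commonValue S F = some y := by
  have h' : ∃ y, ∀ x ∈ S, F x = y := ⟨y, h⟩
  unfold commonValue
  rw [dif_pos h']
  obtain ⟨x, hx⟩ := hS
  rw [← h'.choose_spec x hx, h x hx]

lemma commonValue_mono {ι β : Type} {S S' : Set ι} {F : ι → β} {y : β}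
    (h : commonValue S F = some y) (hS : S' ⊆ S) (hne : S'.Nonempty) :
    commonValue S' F = some y :=
  commonValue_eq_some (fun _ hx => eq_of_commonValue h (hS hx)) hne

namespace LocalRules

variable {Arg κ Out : Type} (R : LocalRules Arg κ Out)

/-- In every round each vertex sends all values that it knows to its neighbours, and then it assigns
every variable whose value is determined by what it knows. It answers as soon as its answer is
determined. -/
noncomputable def toAlgorithm : LocalAlgorithm Arg Out where
  State := Arg × ℕ × (κ → Option ℕ)
  Msg := κ → Option ℕ
  init x i := (x, i, fun _ => none)
  send s _ := s.2.2
  receive s M := (s.1, s.2.1, fun k =>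
    commonValue {q : (κ → ℕ) × (ℕ → Option (κ → ℕ)) | Extends q.1 s.2.2 ∧ ExtendsInbox q.2 M}
      (fun q => R.value s.1 s.2.1 q.1 q.2 k))
  output s := commonValue {f : κ → ℕ | Extends f s.2.2} (R.answer s.1)

variable {V : Type u} (G : SimpleGraph V) (ident : V → ℕ) (x : Arg)

/-- The values that `v` knows after `r` rounds. -/
noncomputable def table (r : ℕ) (v : V) : κ → Option ℕ :=
  (R.toAlgorithm.config G ident x r v).2.2

lemma config_eq (r : ℕ) (v : V) :
    R.toAlgorithm.config G ident x r v = (x, ident v, R.table G ident x r v) := by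
  induction r with
  | zero => rfl
  | succ r ih =>
    have h1 : (R.toAlgorithm.config G ident x (r + 1) v).1 =
      (R.toAlgorithm.config G ident x r v).1 := rfl
    have h2 : (R.toAlgorithm.config G ident x (r + 1) v).2.1 =
      (R.toAlgorithm.config G ident x r v).2.1 := rfl
    rw [ih] at h1 h2
    exact Prod.ext h1 (Prod.ext h2 rfl)

lemma table_zero (v : V) (k : κ) : R.table G ident x 0 v k = none := rfl

lemma table_succ (r : ℕ) (v : V) (k : κ) :
    R.table G ident x (r + 1) v k =
      commonValue {q : (κ → ℕ) × (ℕ → Option (κ → ℕ)) | Extends q.1 (R.table G ident x r v) ∧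
          ExtendsInbox q.2 (neighborTable G ident (R.table G ident x r) v)}
        (fun q => R.value x (ident v) q.1 q.2 k) := by
  have h : R.table G ident x (r + 1) v k = commonValue
      {q : (κ → ℕ) × (ℕ → Option (κ → ℕ)) |
          Extends q.1 (R.toAlgorithm.config G ident x r v).2.2 ∧
          ExtendsInbox q.2 (neighborTable G ident (R.table G ident x r) v)}
        (fun q => R.value (R.toAlgorithm.config G ident x r v).1
          (R.toAlgorithm.config G ident x r v).2.1 q.1 q.2 k) := rfl
  rw [h, config_eq]

lemma extendsInbox_neighborTable {g : V → κ → ℕ} {s : V → κ → Option ℕ}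
    (h : ∀ w, Extends (g w) (s w)) (v : V) :
    ExtendsInbox (neighborTable G ident g v) (neighborTable G ident s v) := by
  intro j
  unfold neighborTable
  split_ifs with hj
  · refine ⟨fun e => e.elim, fun t ht => ⟨_, rfl, ?_⟩⟩
    rw [← Option.some.inj ht]
    exact h _
  · exact ⟨fun _ => rfl, fun t ht => by cases ht⟩

lemma exists_extends (s : κ → Option ℕ) : ∃ f, Extends f s :=
  ⟨fun k => (s k).getD 0, fun k y h => by simp [h]⟩

/-- Irrevocability: more knowledge leaves fewer completions, and a common value survives on a
smaller nonempty set. -/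
lemma table_mono_succ (r : ℕ) (v : V) (k : κ) (y : ℕ)
    (h : R.table G ident x r v k = some y) : R.table G ident x (r + 1) v k = some y := by
  induction r generalizing v k y with
  | zero => simp [table_zero] at h
  | succ r ih =>
    rw [table_succ] at h ⊢
    refine commonValue_mono h ?_ ?_
    · rintro ⟨f, N⟩ ⟨h1, h2⟩
      refine ⟨fun k y e => h1 k y (ih v k y e), fun j => ?_⟩
      have h3 := h2 j
      unfold neighborTable at h3 ⊢
      split_ifs at h3 ⊢ with hj
      · refine ⟨fun e => e.elim, fun t ht => ?_⟩
        obtain ⟨f', e1, e2⟩ := h3.2 _ rfl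
        refine ⟨f', e1, ?_⟩
        rw [← Option.some.inj ht]
        exact fun k y e => e2 k y (ih _ k y e)
      · exact ⟨fun _ => h3.1 rfl, fun t ht => by cases ht⟩
    -- Arbitrary completions of the current tables show that the smaller set is not empty.
    · choose g hg using fun w => exists_extends (R.table G ident x (r + 1) w)
      exact ⟨(g v, neighborTable G ident g v), hg v, extendsInbox_neighborTable G ident hg v⟩

lemma table_mono {r r' : ℕ} (hr : r ≤ r') {v : V} {k : κ} {y : ℕ}
    (h : R.table G ident x r v k = some y) : R.table G ident x r' v k = some y := by
  induction r', hr using Nat.le_induction with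
  | base => exact h
  | succ n _ ih => exact R.table_mono_succ G ident x n v k y ih

/-- After `r` rounds `v` knows the value of its variable `k`. -/
def Known (r : ℕ) (v : V) (k : κ) : Prop := ∃ y, R.table G ident x r v k = some y

lemma Known.mono {R : LocalRules Arg κ Out} {G : SimpleGraph V} {ident : V → ℕ} {x : Arg}
    {r r' : ℕ} {v : V} {k : κ} (h : R.Known G ident x r v k)
    (hr : r ≤ r') : R.Known G ident x r' v k :=
  ⟨_, R.table_mono G ident x hr h.choose_spec⟩

open Classical in
/-- The value that the variable `k` of `v` eventually gets (and `0` if it does not get any). -/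
noncomputable def final (v : V) (k : κ) : ℕ :=
  if h : ∃ r, R.Known G ident x r v k then h.choose_spec.choose else 0

lemma final_eq {r : ℕ} {v : V} {k : κ} {y : ℕ} (h : R.table G ident x r v k = some y) :
    R.final G ident x v k = y := by
  have h' : ∃ r, R.Known G ident x r v k := ⟨r, y, h⟩
  unfold final
  rw [dif_pos h']
  have h1 := R.table_mono G ident x (le_max_left r h'.choose) h
  have h2 := R.table_mono G ident x (le_max_right r h'.choose) h'.choose_spec.choose_spec
  exact Option.some.inj (h2.symm.trans h1)

lemma extends_final (r : ℕ) (v : V) :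
    Extends (R.final G ident x v) (R.table G ident x r v) :=
  fun _ _ h => R.final_eq G ident x h

/-- The final tables are among the completions over which the common value was taken. Any knowledge
bound thus yields the defining equation of the variable. -/
lemma Known.final_eq_value {R : LocalRules Arg κ Out} {G : SimpleGraph V} {ident : V → ℕ} {x : Arg}
    {r : ℕ} {v : V} {k : κ} (h : R.Known G ident x r v k) :
    R.final G ident x v k = R.value x (ident v) (R.final G ident x v)
      (neighborTable G ident (R.final G ident x) v) k := by
  obtain ⟨y, hy⟩ := h
  rw [R.final_eq G ident x hy]
  cases r with
  | zero => simp [table_zero] at hy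
  | succ r =>
    rw [table_succ] at hy
    exact (eq_of_commonValue hy (x := (R.final G ident x v,
      neighborTable G ident (R.final G ident x) v)) ⟨R.extends_final G ident x r v,
        extendsInbox_neighborTable G ident (R.extends_final G ident x r) v⟩).symm

/-- A variable is known one round after its value is determined by the known variables. -/
lemma known_succ (hid : Function.Injective ident) {r : ℕ} {v : V} {k : κ}
    (h : ∀ g : V → κ → ℕ, (∀ w k', R.Known G ident x r w k' → g w k' = R.final G ident x w k') →
      R.value x (ident v) (g v) (neighborTable G ident g v) k =
        R.value x (ident v) (R.final G ident x v)
          (neighborTable G ident (R.final G ident x) v) k) :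
    R.Known G ident x (r + 1) v k := by
  classical
  refine ⟨R.value x (ident v) (R.final G ident x v)
    (neighborTable G ident (R.final G ident x) v) k, ?_⟩
  rw [table_succ]
  refine commonValue_eq_some ?_ ⟨(R.final G ident x v,
      neighborTable G ident (R.final G ident x) v), R.extends_final G ident x r v,
        extendsInbox_neighborTable G ident (R.extends_final G ident x r) v⟩
  rintro ⟨f, N⟩ ⟨h1, h2⟩
  have hN : ∀ w, G.Adj v w → ∃ f, N (ident w) = some f ∧ Extends f (R.table G ident x r w) :=
    fun w hw => (h2 (ident w)).2 _ ((neighborTable_eq_some_iff hid).2 ⟨w, hw, rfl, rfl⟩)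
  -- A candidate pair `(f, N)` is realized by one global assignment: `f` at `v`, the tables in `N`
  -- at its neighbours, final values elsewhere. Injective identities keep these consistent.
  let g : V → κ → ℕ := fun w =>
    if hw : G.Adj v w then (hN w hw).choose else if w = v then f else R.final G ident x w
  have hgv : g v = f := by simp [g]
  have hg : neighborTable G ident g v = N := by
    funext j
    by_cases hj : ∃ w, G.Adj v w ∧ ident w = j
    · obtain ⟨w, hw, rfl⟩ := hj
      rw [(hN w hw).choose_spec.1, neighborTable_eq_some_iff hid]
      exact ⟨w, hw, rfl, by simp [g, hw]⟩
    · have e : neighborTable G ident g v j = none := by simp only [neighborTable, dif_neg hj]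
      have e' : neighborTable G ident (R.table G ident x r) v j = none := by
        simp only [neighborTable, dif_neg hj]
      rw [e]; exact ((h2 j).1 e').symm
  have := h g ?_
  · rw [hg, hgv] at this
    exact this
  · rintro w k' ⟨z, hz⟩
    rw [R.final_eq G ident x hz]
    by_cases hw : G.Adj v w
    · simp only [g, dif_pos hw]
      exact (hN w hw).choose_spec.2 k' z hz
    · by_cases hwv : w = v
      · subst hwv
        rw [hgv]
        exact h1 k' z hz
      · simp only [g, dif_neg hw, if_neg hwv]
        exact R.final_eq G ident x hz

/-- The answer need only depend on variables known by round `T`. No other answer can appear earlier,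
as the final table is always a possible completion. -/
lemma computesWithin {T : ℕ}
    (h : ∀ v f, (∀ k, R.Known G ident x T v k → f k = R.final G ident x v k) →
      R.answer x f = R.answer x (R.final G ident x v)) :
    R.toAlgorithm.ComputesWithin G ident x T (fun v => R.answer x (R.final G ident x v)) := by
  have hout : ∀ r v, R.toAlgorithm.output (R.toAlgorithm.config G ident x r v) =
      commonValue {f : κ → ℕ | Extends f (R.table G ident x r v)} (R.answer x) := by
    intro r v
    rw [config_eq]
    rfl
  refine ⟨fun v r hr => ?_, fun v r y hy => ?_⟩
  · rw [hout]
    refine commonValue_eq_some (fun f hf => h v f ?_) ⟨_, R.extends_final G ident x r v⟩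
    rintro k ⟨y, hy⟩
    rw [R.final_eq G ident x hy]
    exact hf k y (R.table_mono G ident x hr hy)
  · rw [hout] at hy
    exact (eq_of_commonValue hy (R.extends_final G ident x r v)).symm

end LocalRules

/-! ## Orientations of bounded out-degree and arboricity -/

/-- The relation `E` can be oriented with out-degree at most `D` (an edge may get both
orientations). -/
def OrientableWithin {V : Type u} (E : V → V → Prop) (D : ℕ) : Prop :=
  ∃ O : V → V → Prop, (∀ v w, E v w → O v w ∨ O w v) ∧ ∀ v, {w | O v w}.ncard ≤ D

/-- The vertex of least rank on a cycle would have two distinct greater neighbours, its successor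
and its predecessor. -/
lemma isAcyclic_of_unique_greater {V : Type u} {L : Type*} [LinearOrder L] {F : SimpleGraph V}
    (rank : V → L) (hrank : Function.Injective rank)
    (h : ∀ v w w', F.Adj v w → F.Adj v w' → rank v < rank w → rank v < rank w' → w = w') :
    F.IsAcyclic := by
  classical
  intro v c hc
  obtain ⟨u, hu, hmin⟩ := c.support.toFinset.exists_min_image rank ⟨v, by simp⟩
  rw [List.mem_toFinset] at hu
  have hc' := hc.rotate hu
  set c' := c.rotate u hu with hc'def
  have hmem : ∀ w ∈ c'.support, rank u ≤ rank w := by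
    intro w hw
    refine hmin w ?_
    rw [List.mem_toFinset]
    exact (c.mem_support_rotate_iff u hu).1 hw
  have hlt : ∀ w ∈ c'.support, F.Adj u w → rank u < rank w := fun w hw ha =>
    lt_of_le_of_ne (hmem w hw) (fun e => ha.ne (hrank e))
  have a1 : F.Adj u c'.snd := c'.adj_snd hc'.not_nil
  have a2 : F.Adj u c'.penultimate := (c'.adj_penultimate hc'.not_nil).symm
  refine hc'.snd_ne_penultimate (h u _ _ a1 a2 (hlt _ ?_ a1) (hlt _ ?_ a2))
  · exact c'.getVert_mem_support 1
  · exact c'.getVert_mem_support _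

lemma exists_injOn_lt {V : Type u} [Finite V] (s : Set V) :
    ∃ f : V → ℕ, Set.InjOn f s ∧ ∀ w ∈ s, f w < s.ncard := by
  classical
  have hs := s.toFinite
  let e := hs.toFinset.equivFin
  refine ⟨fun w => if h : w ∈ hs.toFinset then e ⟨w, h⟩ else 0, ?_, ?_⟩
  · intro w hw w' hw' he
    have h1 : w ∈ hs.toFinset := hs.mem_toFinset.2 hw
    have h2 : w' ∈ hs.toFinset := hs.mem_toFinset.2 hw'
    simp only [dif_pos h1, dif_pos h2] at he
    simpa using e.injective (Fin.ext he)
  · intro w hw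
    have h1 : w ∈ hs.toFinset := hs.mem_toFinset.2 hw
    simp only [dif_pos h1]
    rw [Set.ncard_eq_toFinset_card s hs]
    exact (e ⟨w, h1⟩).2

/-- Number the upward edges at each vertex; the edges of number `i` form the `i`-th forest, since
each vertex has at most one of them going up. -/
lemma hasForestsDecomposition_of_rank {V : Type u} [Finite V] {L : Type*} [LinearOrder L]
    {G : SimpleGraph V} (rank : V → L) (hrank : Function.Injective rank) {r : ℕ}
    (h : ∀ v, {w | G.Adj v w ∧ rank v < rank w}.ncard ≤ r) : HasForestsDecomposition G r := by
  choose f hf hf' using fun v => exists_injOn_lt {w | G.Adj v w ∧ rank v < rank w}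
  let F : Fin r → SimpleGraph V := fun i =>
    { Adj := fun v w => G.Adj v w ∧
        ((rank v < rank w ∧ f v w = i) ∨ (rank w < rank v ∧ f w v = i))
      symm := ⟨fun v w hvw => ⟨hvw.1.symm, hvw.2.symm⟩⟩
      loopless := ⟨fun v hv => hv.1.ne rfl⟩ }
  have hup : ∀ i v w, (F i).Adj v w → rank v < rank w → G.Adj v w ∧ f v w = i := by
    rintro i v w ⟨h1, h2 | h2⟩ h3
    · exact ⟨h1, h2.2⟩
    · exact absurd h2.1 h3.asymm
  refine ⟨F, fun i => ?_, fun i j hij => ?_, ?_⟩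
  · refine isAcyclic_of_unique_greater rank hrank fun v w w' h1 h2 h3 h4 => ?_
    have e1 := hup i v w h1 h3
    have e2 := hup i v w' h2 h4
    exact hf v ⟨e1.1, h3⟩ ⟨e2.1, h4⟩ (e1.2.trans e2.2.symm)
  · rw [SimpleGraph.disjoint_left]
    rintro v w ⟨-, h1⟩ ⟨-, h2⟩
    refine hij (Fin.ext ?_)
    rcases h1 with h1 | h1 <;> rcases h2 with h2 | h2
    · exact h1.2.symm.trans h2.2
    · exact absurd h1.1 h2.1.asymm
    · exact absurd h1.1 h2.1.asymm
    · exact h1.2.symm.trans h2.2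
  · ext v w
    rw [SimpleGraph.iSup_adj]
    constructor
    · rintro ⟨i, hi⟩
      exact hi.1
    · intro hvw
      rcases lt_or_gt_of_ne (fun e => hvw.ne (hrank e) : rank v ≠ rank w) with hlt | hlt
      · exact ⟨⟨f v w, (hf' v w ⟨hvw, hlt⟩).trans_le (h v)⟩, hvw, Or.inl ⟨hlt, rfl⟩⟩
      · exact ⟨⟨f w v, (hf' w v ⟨hvw.symm, hlt⟩).trans_le (h w)⟩, hvw, Or.inr ⟨hlt, rfl⟩⟩

lemma arboricity_le_of_rank {V : Type u} [Finite V] {L : Type*} [LinearOrder L]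
    {G : SimpleGraph V} (rank : V → L) (hrank : Function.Injective rank) {r : ℕ}
    (h : ∀ v, {w | G.Adj v w ∧ rank v < rank w}.ncard ≤ r) : arboricity G ≤ r :=
  Nat.sInf_le (hasForestsDecomposition_of_rank rank hrank h)

/-- The infimum is attained because some decomposition exists; over an empty set `sInf` would be the
junk value `0`. -/
lemma hasForestsDecomposition_arboricity {V : Type u} [Finite V] (G : SimpleGraph V) :
    HasForestsDecomposition G (arboricity G) := by
  obtain ⟨n, ⟨e⟩⟩ := Finite.exists_equiv_fin V
  have : ({k | HasForestsDecomposition G k} : Set ℕ).Nonempty :=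
    ⟨Nat.card V, hasForestsDecomposition_of_rank e e.injective fun v => Set.ncard_le_card _⟩
  exact Nat.sInf_mem this

/-- Orient each edge towards a root of its tree. The out-neighbour is the penultimate vertex of the
unique path from the root. -/
lemma exists_orientation_of_isAcyclic {V : Type u} {F : SimpleGraph V} (hF : F.IsAcyclic) :
    ∃ O : V → V → Prop, (∀ v w, F.Adj v w → O v w ∨ O w v) ∧
      ∀ v w w', O v w → O v w' → w = w' := by
  classical
  let root : V → V := fun v => (F.connectedComponentMk v).out
  have hroot : ∀ v, F.Reachable (root v) v := fun v =>
    SimpleGraph.ConnectedComponent.exact (Quot.out_eq (F.connectedComponentMk v))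
  have hroot' : ∀ v w, F.Adj v w → root v = root w := fun v w h => by
    simp only [root, SimpleGraph.ConnectedComponent.sound h.reachable]
  refine ⟨fun v w => F.Adj v w ∧ F.dist (root v) v = F.dist (root v) w + 1, ?_, ?_⟩
  · intro v w hvw
    rcases hF.dist_eq_dist_add_one_of_adj_of_reachable (root v) hvw (hroot v) with h | h
    · exact Or.inl ⟨hvw, h⟩
    · exact Or.inr ⟨hvw.symm, hroot' v w hvw ▸ h⟩
  · intro v
    obtain ⟨p, hp, -⟩ := (hroot v).exists_path_of_dist
    have key : ∀ w, F.Adj v w → F.dist (root v) v = F.dist (root v) w + 1 →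
        p.penultimate = w := by
      intro w hvw hd
      obtain ⟨q, hq, hq'⟩ := ((hroot v).trans hvw.reachable).exists_path_of_dist
      -- A shortest path to `w` through `v` would put `v` no farther from the root than `w`.
      have hv : v ∉ q.support := by
        intro hv
        have h1 := SimpleGraph.dist_le (q.takeUntil v hv)
        have h2 := q.length_takeUntil_le_length hv
        omega
      have hc : (q.concat hvw.symm).IsPath := hq.concat hv hvw.symm
      have hpq : p = q.concat hvw.symm :=
        congrArg Subtype.val ((hF.subsingleton_path _ _).elim ⟨p, hp⟩ ⟨_, hc⟩)
      rw [hpq]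
      simp
    intro w w' h1 h2
    rw [← key w h1.1 h1.2, ← key w' h2.1 h2.2]

/-- Each forest contributes at most one out-neighbour. -/
lemma orientableWithin_arboricity {V : Type u} [Finite V] (G : SimpleGraph V) :
    OrientableWithin G.Adj (arboricity G) := by
  classical
  obtain ⟨F, hF, -, hsup⟩ := hasForestsDecomposition_arboricity G
  choose O hO hO' using fun i => exists_orientation_of_isAcyclic (hF i)
  refine ⟨fun v w => ∃ i, O i v w, fun v w hvw => ?_, fun v => ?_⟩
  · rw [← hsup, SimpleGraph.iSup_adj] at hvw
    obtain ⟨i, hi⟩ := hvw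
    rcases hO i v w hi with h | h
    · exact Or.inl ⟨i, h⟩
    · exact Or.inr ⟨i, h⟩
  · let f : Fin (arboricity G) → V := fun i => if h : ∃ w, O i v w then h.choose else v
    have hsub : {w | ∃ i, O i v w} ⊆ Set.range f := by
      rintro w ⟨i, hi⟩
      have h : ∃ w, O i v w := ⟨w, hi⟩
      exact ⟨i, by simp only [f, dif_pos h]; exact hO' i v _ _ h.choose_spec hi⟩
    refine (Set.ncard_le_ncard hsub (Set.finite_range f)).trans ?_
    rw [← Set.image_univ]
    refine (Set.ncard_image_le (Set.toFinite (Set.univ : Set (Fin (arboricity G))))).trans ?_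
    rw [Set.ncard_univ, Nat.card_fin]

/-- If every vertex of `S'` has more than `D` neighbours in `S`, then `S'` is small. -/
lemma OrientableWithin.card_mul_le {V : Type u} [Fintype V] {E : V → V → Prop} {α D : ℕ}
    (hE : OrientableWithin E α) {S S' : Finset V} (hS : S' ⊆ S)
    (h : ∀ v ∈ S', D < {w | E v w ∧ w ∈ S}.ncard) : S'.card * (D + 1) ≤ 2 * α * S.card := by
  classical
  obtain ⟨O, hO, hO'⟩ := hE
  have hout : ∀ v, (S.filter (fun w => O v w)).card ≤ α := fun v => by
    refine le_trans ?_ (hO' v)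
    rw [← Set.ncard_coe_finset]
    exact Set.ncard_le_ncard (fun w hw => (Finset.mem_filter.1 hw).2) (Set.toFinite _)
  have h1 : ∀ v ∈ S', D + 1 ≤ (S.filter (fun w => O v w)).card +
      (S.filter (fun w => O w v)).card := fun v hv => by
    refine Nat.succ_le_of_lt ((h v hv).trans_le (le_trans ?_ (Finset.card_union_le _ _)))
    rw [← Set.ncard_coe_finset]
    refine Set.ncard_le_ncard (fun w hw => ?_) (Finset.finite_toSet _)
    simp only [Finset.coe_union, Finset.coe_filter, Set.mem_union, Set.mem_ofPred_eq]
    rcases hO v w hw.1 with h | h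
    · exact Or.inl ⟨hw.2, h⟩
    · exact Or.inr ⟨hw.2, h⟩
  calc S'.card * (D + 1) = ∑ v ∈ S', (D + 1) := by rw [Finset.sum_const, smul_eq_mul]
    _ ≤ ∑ v ∈ S', ((S.filter (fun w => O v w)).card + (S.filter (fun w => O w v)).card) :=
        Finset.sum_le_sum h1
    _ ≤ ∑ v ∈ S, ((S.filter (fun w => O v w)).card + (S.filter (fun w => O w v)).card) :=
        Finset.sum_le_sum_of_subset hS
    -- Within `S`, in-degrees and out-degrees have the same sum.
    _ = 2 * ∑ v ∈ S, (S.filter (fun w => O v w)).card := by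
        rw [Finset.sum_add_distrib, two_mul]
        congr 1
        simp only [Finset.card_filter]
        exact Finset.sum_comm
    _ ≤ 2 * ∑ v ∈ S, α := by gcongr with v; exact hout v
    _ = 2 * α * S.card := by rw [Finset.sum_const, smul_eq_mul]; ring

/-! ## Runs of Procedure Arbdefective-Coloring on the classes of a coloring -/

lemma ncard_colorClass {V : Type u} {G : SimpleGraph V} {φ : V → ℕ} {g : ℕ}
    (v : {v | φ v = g}) (P : V → Prop) :
    {w | (colorClass G φ g).Adj v w ∧ P w}.ncard =
      {w | G.Adj v w ∧ φ w = φ v ∧ P w}.ncard := by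
  have hv : φ v = g := v.2
  rw [← Set.ncard_image_of_injective _ Subtype.val_injective]
  congr 1
  ext w
  constructor
  · rintro ⟨⟨w, hw⟩, ⟨h1, h2⟩, rfl⟩
    exact ⟨h1, hw.trans hv.symm, h2⟩
  · rintro ⟨h1, h2, h3⟩
    exact ⟨⟨w, h2.trans hv⟩, ⟨h1, h3⟩, rfl⟩

lemma ncard_colorClass_and {V : Type u} {G : SimpleGraph V} {φ : V → ℕ} {g : ℕ}
    (v : {v | φ v = g}) (P Q : V → Prop) :
    {w : {v | φ v = g} | ((colorClass G φ g).Adj v w ∧ P w) ∧ Q w}.ncard =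
      {w | G.Adj v w ∧ φ w = φ v ∧ P w ∧ Q w}.ncard := by
  rw [← ncard_colorClass v (fun w => P w ∧ Q w)]
  simp only [and_assoc]

/-- The results `h`, `d`, `c` of Procedure Arbdefective-Coloring carried out on all classes of the
coloring `φ`, in terms of `G` itself. -/
structure IsParallelRun {V : Type u} (ε K : ℝ) (n : ℕ) (G : SimpleGraph V) (φ : V → ℕ)
    (α k t : ℕ) (h d c : V → ℕ) : Prop where
  one_le_index : ∀ v, 1 ≤ h v
  index_le : ∀ v, (h v : ℝ) ≤ K * Real.logb 2 n
  degree_le : ∀ v, {w | G.Adj v w ∧ φ w = φ v ∧ h v ≤ h w}.ncard ≤ ⌊(2 + ε) * α⌋₊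
  one_le_def : ∀ v, 1 ≤ d v
  def_le : ∀ v, (d v : ℝ) ≤ K * (t : ℝ) ^ 2
  defect_le : ∀ v, {w | G.Adj v w ∧ φ w = φ v ∧ h w = h v ∧ d w = d v}.ncard ≤ α / t
  one_le_color : ∀ v, 1 ≤ c v
  color_le : ∀ v, c v ≤ k
  ncard_le : ∀ v j, 1 ≤ j → j ≤ k →
    {w | G.Adj v w ∧ φ w = φ v ∧ (h v < h w ∨ (h v = h w ∧ d v < d w)) ∧ c w = c v}.ncard ≤
      {w | G.Adj v w ∧ φ w = φ v ∧ (h v < h w ∨ (h v = h w ∧ d v < d w)) ∧ c w = j}.ncard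

/-- Each vertex lies in exactly one class, so all classes can be treated at once in `G`, without
nested subtypes. -/
lemma forall_isArbdefectiveColoringRun_iff {V : Type u} {ε K : ℝ} {n : ℕ} {G : SimpleGraph V}
    {φ : V → ℕ} {α k t : ℕ} {h d c : V → ℕ} :
    (∀ g, IsArbdefectiveColoringRun ε K n (colorClass G φ g) α k t
      (fun v => h v) (fun v => d v) (fun v => c v)) ↔
    IsParallelRun ε K n G φ α k t h d c := by
  have hdef : ∀ g i (v : {v : {v | φ v = g} | h v = i}),
      {w | (colorClass (colorClass G φ g) (fun v => h v) i).Adj v w ∧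
        d w = d v}.ncard = {w | G.Adj v w ∧ φ w = φ v ∧ h w = h v ∧ d w = d v}.ncard := by
    intro g i v
    rw [ncard_colorClass (G := colorClass G φ g) (φ := fun v => h v) v (fun w => d w = d v),
      ncard_colorClass v.1 (fun w => h w = h v ∧ d w = d v)]
  constructor
  · intro H
    have H' := fun v => H (φ v)
    refine ⟨fun v => ((H' v).1.1.1 ⟨v, rfl⟩).1, fun v => ((H' v).1.1.1 ⟨v, rfl⟩).2, fun v => ?_,
      fun v => (((H' v).1.2 (h v)).1 ⟨⟨v, rfl⟩, rfl⟩).1,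
      fun v => (((H' v).1.2 (h v)).1 ⟨⟨v, rfl⟩, rfl⟩).2, fun v => ?_,
      fun v => ((H' v).2 ⟨v, rfl⟩).1.1, fun v => ((H' v).2 ⟨v, rfl⟩).1.2,
      fun v j h1 h2 => ?_⟩
    · have := (H' v).1.1.2 ⟨v, rfl⟩
      rwa [ncard_colorClass (G := G) (φ := φ) (g := φ v) ⟨v, rfl⟩ (fun w => h v ≤ h w)] at this
    · have := ((H' v).1.2 (h v)).2 ⟨⟨v, rfl⟩, rfl⟩
      exact (hdef (φ v) (h v) ⟨⟨v, rfl⟩, rfl⟩).symm.trans_le this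
    · have := ((H' v).2 ⟨v, rfl⟩).2 j h1 h2
      simp only [IsParent] at this
      rwa [ncard_colorClass_and (G := G) (φ := φ) (g := φ v) ⟨v, rfl⟩
        (fun w => h v < h w ∨ (h v = h w ∧ d v < d w)) (fun w => c w = c v),
        ncard_colorClass_and (G := G) (φ := φ) (g := φ v) ⟨v, rfl⟩
        (fun w => h v < h w ∨ (h v = h w ∧ d v < d w)) (fun w => c w = j)] at this
  · intro H g
    refine ⟨⟨⟨fun v => ⟨H.one_le_index v, H.index_le v⟩, fun v => ?_⟩, fun i =>
      ⟨fun v => ⟨H.one_le_def _, H.def_le _⟩, fun v => ?_⟩⟩,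
      fun v => ⟨⟨H.one_le_color v, H.color_le v⟩, fun j h1 h2 => ?_⟩⟩
    · rw [ncard_colorClass v (fun w => h v ≤ h w)]
      exact H.degree_le v
    · rw [hdef g i v]
      exact H.defect_le v
    · simp only [IsParent]
      rw [ncard_colorClass_and v (fun w => h v < h w ∨ (h v = h w ∧ d v < d w))
          (fun w => c w = c v),
        ncard_colorClass_and v (fun w => h v < h w ∨ (h v = h w ∧ d v < d w))
          (fun w => c w = j)]
      exact H.ncard_le v j h1 h2

/-- The position of a vertex in the acyclic orientation that completes the partial orientation. -/
def orientationRank {V : Type u} (h d e : V → ℕ) (v : V) : ℕ ×ₗ ℕ ×ₗ ℕ :=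
  toLex (h v, toLex (d v, e v))

lemma orientationRank_injective {V : Type u} {h d e : V → ℕ} (he : Function.Injective e) :
    Function.Injective (orientationRank h d e) := by
  intro v w hvw
  simp only [orientationRank, EmbeddingLike.apply_eq_iff_eq, Prod.mk.injEq] at hvw
  exact he hvw.2.2

lemma orientationRank_lt_iff {V : Type u} {h d e : V → ℕ} {v w : V} :
    orientationRank h d e v < orientationRank h d e w ↔
      h v < h w ∨ h v = h w ∧ (d v < d w ∨ d v = d w ∧ e v < e w) := by
  simp [orientationRank, Prod.Lex.toLex_lt_toLex]

namespace IsParallelRun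

variable {V : Type u} {ε K : ℝ} {n : ℕ} {G : SimpleGraph V}
    {φ : V → ℕ} {α k t : ℕ} {h d c : V → ℕ}

/-- Pigeonhole: the parents split over `k` colours, and the colour of `v` is a least used one. -/
lemma mul_ncard_parents_le [Finite V] (H : IsParallelRun ε K n G φ α k t h d c) (v : V) :
    k * {w | G.Adj v w ∧ φ w = φ v ∧ (h v < h w ∨ (h v = h w ∧ d v < d w)) ∧ c w = c v}.ncard ≤
      ⌊(2 + ε) * α⌋₊ := by
  classical
  have := Fintype.ofFinite V
  refine le_trans ?_ (H.degree_le v)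
  set P : Finset V := Finset.univ.filter
    (fun w => G.Adj v w ∧ φ w = φ v ∧ (h v < h w ∨ (h v = h w ∧ d v < d w))) with hP
  have h1 : ∀ j, {w | G.Adj v w ∧ φ w = φ v ∧ (h v < h w ∨ (h v = h w ∧ d v < d w)) ∧
      c w = j}.ncard = (P.filter (fun w => c w = j)).card := by
    intro j
    rw [← Set.ncard_coe_finset]
    congr 1
    ext w
    simp [hP, and_assoc]
  have h2 : P.card = ∑ j ∈ Finset.Icc 1 k, (P.filter (fun w => c w = j)).card :=
    Finset.card_eq_sum_card_fiberwise fun w _ =>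
      Finset.mem_coe.2 (Finset.mem_Icc.2 ⟨H.one_le_color w, H.color_le w⟩)
  have h3 : P.card ≤ {w | G.Adj v w ∧ φ w = φ v ∧ h v ≤ h w}.ncard := by
    rw [← Set.ncard_coe_finset]
    refine Set.ncard_le_ncard (fun w hw => ?_) (Set.toFinite _)
    obtain ⟨-, h1, h2, h3⟩ := Finset.mem_filter.1 (Finset.mem_coe.1 hw)
    exact ⟨h1, h2, by omega⟩
  refine le_trans ?_ h3
  rw [h2]
  calc _ = ∑ j ∈ Finset.Icc 1 k, {w | G.Adj v w ∧ φ w = φ v ∧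
        (h v < h w ∨ (h v = h w ∧ d v < d w)) ∧ c w = c v}.ncard := by simp
    _ ≤ _ := Finset.sum_le_sum fun j hj => by
      rw [← h1]
      exact H.ncard_le v j (Finset.mem_Icc.1 hj).1 (Finset.mem_Icc.1 hj).2

/-- A greater neighbour of the same new class is a parent of equal colour, or agrees in `h` and `d`
and counts towards the defect. -/
lemma ncard_greater_le [Finite V] (H : IsParallelRun ε K n G φ α k t h d c) (hk : 0 < k)
    (e : V → ℕ) (v : V) :
    {w | G.Adj v w ∧ φ w = φ v ∧ c w = c v ∧
      orientationRank h d e v < orientationRank h d e w}.ncard ≤ ⌊(2 + ε) * α⌋₊ / k + α / t := by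
  have h1 := (Nat.le_div_iff_mul_le hk).2 ((mul_comm _ _).trans_le (H.mul_ncard_parents_le v))
  refine le_trans ?_ (Nat.add_le_add h1 (H.defect_le v))
  refine le_trans (Set.ncard_le_ncard ?_ (Set.toFinite _)) (Set.ncard_union_le _ _)
  rintro w ⟨h1, h2, h3, h4⟩
  rw [orientationRank_lt_iff] at h4
  simp only [Set.mem_union, Set.mem_ofPred_eq]
  rcases h4 with h4 | ⟨h4, h5 | h5⟩
  · exact Or.inl ⟨h1, h2, Or.inl h4, h3⟩
  · exact Or.inl ⟨h1, h2, Or.inr ⟨h4, h5⟩, h3⟩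
  · exact Or.inr ⟨h1, h2, h4.symm, h5.1.symm⟩

/-- Carries the density bound to the next iteration; `ψ` will be the next part index. -/
lemma orientableWithin [Finite V] (H : IsParallelRun ε K n G φ α k t h d c) (hk : 0 < k)
    {ψ : V → ℕ} (hψ : ∀ v w, ψ w = ψ v → φ w = φ v ∧ c w = c v) :
    OrientableWithin (fun v w => G.Adj v w ∧ ψ w = ψ v) (⌊(2 + ε) * α⌋₊ / k + α / t) := by
  obtain ⟨N, ⟨e⟩⟩ := Finite.exists_equiv_fin V
  let e' : V → ℕ := fun v => e v
  have he : Function.Injective e' := fun v w hvw => e.injective (Fin.ext hvw)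
  refine ⟨fun v w => G.Adj v w ∧ φ w = φ v ∧ c w = c v ∧
    orientationRank h d e' v < orientationRank h d e' w, ?_, H.ncard_greater_le hk e'⟩
  rintro v w ⟨hvw, h1⟩
  obtain ⟨h2, h3⟩ := hψ v w h1
  rcases lt_or_gt_of_ne (fun e => hvw.ne (orientationRank_injective he e) :
      orientationRank h d e' v ≠ orientationRank h d e' w) with hlt | hlt
  · exact Or.inl ⟨hvw, h2, h3, hlt⟩
  · exact Or.inr ⟨hvw.symm, h2.symm, h3.symm, hlt⟩

lemma arboricity_le [Finite V] (H : IsParallelRun ε K n G φ α k t h d c) (hk : 0 < k)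
    (g j : ℕ) :
    arboricity (colorClass (colorClass G φ g) (fun v => c v) j) ≤ ⌊(2 + ε) * α⌋₊ / k + α / t := by
  obtain ⟨N, ⟨e⟩⟩ := Finite.exists_equiv_fin V
  let e' : V → ℕ := fun v => e v
  have he : Function.Injective e' := fun v w hvw => e.injective (Fin.ext hvw)
  refine arboricity_le_of_rank (fun v => orientationRank h d e' v.1.1)
    (fun v w hvw => Subtype.ext (Subtype.ext (orientationRank_injective he hvw))) fun v => ?_
  rw [ncard_colorClass (G := colorClass G φ g) (φ := fun v => c v) v
      (fun w => orientationRank h d e' v.1.1 < orientationRank h d e' w.1),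
    ncard_colorClass v.1 (fun w => c w = c v.1.1 ∧
      orientationRank h d e' v.1.1 < orientationRank h d e' w)]
  exact H.ncard_greater_le hk e' v.1.1

end IsParallelRun

/-! ## One step of the defective color reduction -/

/-- The value at `b` of the quadratic polynomial over `ZMod q` whose coefficients are the digits of
`x` in base `q`. -/
def evalQuadratic (q x b : ℕ) : ZMod q :=
  ((x % q : ℕ) : ZMod q) + ((x / q % q : ℕ) : ZMod q) * b + ((x / q / q : ℕ) : ZMod q) * b ^ 2

/-- Below `q ^ 3` three digits determine a number, so the difference of the two polynomials is
nonzero of degree at most `2`. -/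
lemma card_evalQuadratic_eq_le {q x y : ℕ} (hq : q.Prime) (hx : x < q ^ 3) (hy : y < q ^ 3)
    (hxy : x ≠ y) :
    ((Finset.range q).filter (fun b => evalQuadratic q y b = evalQuadratic q x b)).card ≤ 2 := by
  classical
  have : Fact q.Prime := ⟨hq⟩
  have hq0 := hq.pos
  have inj : ∀ a b : ℕ, a < q → b < q → (a : ZMod q) = (b : ZMod q) → a = b := by
    intro a b ha hb h
    rw [ZMod.natCast_eq_natCast_iff'] at h
    rwa [Nat.mod_eq_of_lt ha, Nat.mod_eq_of_lt hb] at h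
  set c0 : ZMod q := ((y % q : ℕ) : ZMod q) - ((x % q : ℕ) : ZMod q) with hc0
  set c1 : ZMod q := ((y / q % q : ℕ) : ZMod q) - ((x / q % q : ℕ) : ZMod q) with hc1
  set c2 : ZMod q := ((y / q / q : ℕ) : ZMod q) - ((x / q / q : ℕ) : ZMod q) with hc2
  set P : Polynomial (ZMod q) := Polynomial.C c2 * Polynomial.X ^ 2 +
    Polynomial.C c1 * Polynomial.X + Polynomial.C c0 with hP
  have hP0 : P ≠ 0 := by
    intro h0
    have e0 : c0 = 0 := by simpa [hP] using congrArg (fun p => Polynomial.coeff p 0) h0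
    have e1 : c1 = 0 := by
      simpa [hP, Polynomial.coeff_X, Polynomial.coeff_C] using
        congrArg (fun p => Polynomial.coeff p 1) h0
    have e2 : c2 = 0 := by
      simpa [hP, Polynomial.coeff_X, Polynomial.coeff_C] using
        congrArg (fun p => Polynomial.coeff p 2) h0
    have lt2 : ∀ z, z < q ^ 3 → z / q / q < q := fun z hz => by
      rw [Nat.div_div_eq_div_mul, Nat.div_lt_iff_lt_mul (Nat.mul_pos hq0 hq0)]
      calc z < q ^ 3 := hz
        _ = q * (q * q) := by ring
    have d0 := inj _ _ (Nat.mod_lt _ hq0) (Nat.mod_lt _ hq0) (sub_eq_zero.1 e0)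
    have d1 := inj _ _ (Nat.mod_lt _ hq0) (Nat.mod_lt _ hq0) (sub_eq_zero.1 e1)
    have d2 := inj _ _ (lt2 y hy) (lt2 x hx) (sub_eq_zero.1 e2)
    apply hxy
    rw [← Nat.div_add_mod x q, ← Nat.div_add_mod (x / q) q, ← Nat.div_add_mod y q,
      ← Nat.div_add_mod (y / q) q, d0, d1, d2]
  have hdeg : P.natDegree ≤ 2 := Polynomial.natDegree_quadratic_le
  calc _ ≤ P.roots.toFinset.card := by
        refine Finset.card_le_card_of_injOn (fun b => (b : ZMod q)) ?_ ?_
        · intro b hb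
          obtain ⟨-, hb⟩ := Finset.mem_filter.1 (Finset.mem_coe.1 hb)
          simp only [Finset.mem_coe, Multiset.mem_toFinset, Polynomial.mem_roots hP0,
            Polynomial.IsRoot.def]
          simp only [evalQuadratic] at hb
          simp only [hP, hc0, hc1, hc2, Polynomial.eval_add, Polynomial.eval_mul,
            Polynomial.eval_pow, Polynomial.eval_C, Polynomial.eval_X]
          linear_combination hb
        · intro b hb b' hb' h
          have h1 := (Finset.mem_filter.1 (Finset.mem_coe.1 hb)).1
          have h2 := (Finset.mem_filter.1 (Finset.mem_coe.1 hb')).1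
          exact inj b b' (Finset.mem_range.1 h1) (Finset.mem_range.1 h2) h
    _ ≤ P.roots.card := Multiset.toFinset_card_le _
    _ ≤ 2 := (Polynomial.card_roots' P).trans hdeg

/-- The least `b < k` at which `f` is minimal. -/
noncomputable def argminBelow (k : ℕ) (f : ℕ → ℕ) : ℕ :=
  sInf {b | b < k ∧ ∀ b' < k, f b ≤ f b'}

lemma argminBelow_spec {k : ℕ} (hk : 0 < k) (f : ℕ → ℕ) :
    argminBelow k f < k ∧ ∀ b' < k, f (argminBelow k f) ≤ f b' := by
  have : ({b | b < k ∧ ∀ b' < k, f b ≤ f b'} : Set ℕ).Nonempty := by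
    obtain ⟨b, hb, hmin⟩ := (Finset.range k).exists_min_image f ⟨0, Finset.mem_range.2 hk⟩
    exact ⟨b, Finset.mem_range.1 hb, fun b' hb' => hmin b' (Finset.mem_range.2 hb')⟩
  exact Nat.sInf_mem this

/-- Some evaluation point produces few conflicts with a set `S` of vertices of other colors. -/
lemma argminBelow_evalQuadratic_mul_le {V : Type u} [Finite V] {q : ℕ} (hq : q.Prime)
    (S : Set V) (y : V → ℕ) {x : ℕ} (hx : x < q ^ 3) (hy : ∀ w ∈ S, y w < q ^ 3)
    (hxy : ∀ w ∈ S, y w ≠ x) :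
    {w | w ∈ S ∧ evalQuadratic q (y w) (argminBelow q (fun b =>
        {w | w ∈ S ∧ evalQuadratic q (y w) b = evalQuadratic q x b}.ncard)) =
      evalQuadratic q x (argminBelow q (fun b =>
        {w | w ∈ S ∧ evalQuadratic q (y w) b = evalQuadratic q x b}.ncard))}.ncard * q ≤
      2 * S.ncard := by
  classical
  have := Fintype.ofFinite V
  set f : ℕ → ℕ := fun b => {w | w ∈ S ∧ evalQuadratic q (y w) b = evalQuadratic q x b}.ncard
    with hf
  have hmin := (argminBelow_spec hq.pos f).2
  have hS : S.ncard = S.toFinset.card := Set.ncard_eq_toFinset_card' S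
  have hfb : ∀ b, f b =
      (S.toFinset.filter (fun w => evalQuadratic q (y w) b = evalQuadratic q x b)).card := by
    intro b
    rw [← Set.ncard_coe_finset]
    exact congrArg Set.ncard (by ext w; simp)
  -- Averaging: the minimum is at most the mean over all points, and each `w` conflicts at no more
  -- than two points.
  calc f (argminBelow q f) * q = ∑ b ∈ Finset.range q, f (argminBelow q f) := by
        rw [Finset.sum_const, Finset.card_range, smul_eq_mul, mul_comm]
    _ ≤ ∑ b ∈ Finset.range q, f b :=
        Finset.sum_le_sum fun b hb => hmin b (Finset.mem_range.1 hb)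
    _ = ∑ w ∈ S.toFinset,
        ((Finset.range q).filter
          (fun b => evalQuadratic q (y w) b = evalQuadratic q x b)).card := by
        simp only [hfb, Finset.card_filter]
        exact Finset.sum_comm
    _ ≤ ∑ w ∈ S.toFinset, 2 := Finset.sum_le_sum fun w hw =>
        card_evalQuadratic_eq_le hq hx (hy w (Set.mem_toFinset.1 hw))
          (hxy w (Set.mem_toFinset.1 hw)).symm
    _ = 2 * S.ncard := by rw [Finset.sum_const, smul_eq_mul, hS, mul_comm]

/-- The color of `v` that one step of the color reduction over `ZMod q` produces from the coloring
`c`, where `S v w` says that `w` is a neighbour of `v` in the graph that is colored. -/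
noncomputable def reduceColor {V : Type u} (q : ℕ) (S : V → V → Prop) (c : V → ℕ) (v : V) : ℕ :=
  let b := argminBelow q (fun b =>
    {w | (S v w ∧ c w ≠ c v) ∧ evalQuadratic q (c w) b = evalQuadratic q (c v) b}.ncard)
  b * q + (evalQuadratic q (c v) b).val

/-- The field size for the `j`-th level of the color reduction with parameter `t`. -/
noncomputable def levelPrime (t j : ℕ) : ℕ := sInf {q | q.Prime ∧ 20 * 2 ^ j * t < q}

/-- Bertrand's postulate. -/
lemma levelPrime_spec {t : ℕ} (ht : 0 < t) (j : ℕ) :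
    (levelPrime t j).Prime ∧ 20 * 2 ^ j * t < levelPrime t j ∧
      levelPrime t j ≤ 2 * (20 * 2 ^ j * t) := by
  obtain ⟨q, h1, h2, h3⟩ := Nat.exists_prime_lt_and_le_two_mul (20 * 2 ^ j * t) (by positivity)
  have hmem : q ∈ {q | q.Prime ∧ 20 * 2 ^ j * t < q} := ⟨h1, h2⟩
  obtain ⟨h4, h5⟩ := Nat.sInf_mem ⟨q, hmem⟩
  exact ⟨h4, h5, (Nat.sInf_le hmem).trans h3⟩

lemma levelPrime_palette {t : ℕ} (ht : 0 < t) (j : ℕ) :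
    levelPrime t j ^ 2 + 4 ^ j ≤ 1601 * t ^ 2 * 4 ^ j := by
  obtain ⟨-, -, h⟩ := levelPrime_spec ht j
  have h4 : (4 : ℕ) ^ j = 2 ^ j * 2 ^ j := by rw [← mul_pow]; norm_num
  calc levelPrime t j ^ 2 + 4 ^ j ≤ (2 * (20 * 2 ^ j * t)) ^ 2 + 4 ^ j := by gcongr
    _ = 1600 * t ^ 2 * 4 ^ j + 1 * 4 ^ j := by rw [h4]; ring
    _ ≤ 1600 * t ^ 2 * 4 ^ j + t ^ 2 * 4 ^ j := by
        gcongr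
        exact Nat.one_le_pow _ _ ht
    _ = _ := by ring

/-- Colours of level `j + 1` must fit into three digits in the base of level `j`; this works as `4 *
1601 ≤ 20 ^ 3`. -/
lemma levelPrime_palette_succ {t : ℕ} (ht : 0 < t) (j : ℕ) :
    levelPrime t (j + 1) ^ 2 + 4 ^ (j + 1) ≤ levelPrime t j ^ 3 := by
  have h1 := levelPrime_palette ht (j + 1)
  obtain ⟨-, h, -⟩ := levelPrime_spec ht j
  have h4 : (4 : ℕ) ^ j = 2 ^ j * 2 ^ j := by rw [← mul_pow]; norm_num
  have ht2 : t ^ 2 ≤ t ^ 3 := Nat.pow_le_pow_right ht (by norm_num)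
  have h2j : 1 ≤ 2 ^ j := Nat.one_le_two_pow
  calc _ ≤ 1601 * t ^ 2 * 4 ^ (j + 1) := h1
    _ = 6404 * (t ^ 2) * (2 ^ j * 2 ^ j * 1) := by rw [pow_succ 4 j, h4]; ring
    _ ≤ 8000 * (t ^ 3) * (2 ^ j * 2 ^ j * 2 ^ j) := by gcongr; norm_num
    _ = (20 * 2 ^ j * t) ^ 3 := by ring
    _ ≤ _ := by gcongr

/-! ## The algorithm -/

/-- The number of iterations of the loop. -/
noncomputable def loopLength (ε : ℝ) (a p : ℕ) : ℕ :=
  if p < 16 then 0 else sInf {i | alpha ε a p i ≤ p}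

/-- The bound for the degrees in the `H`-partition of iteration `i + 1`. -/
noncomputable def degreeBound (ε : ℝ) (a p i : ℕ) : ℕ := ⌊(2 + ε) * (alpha ε a p i : ℝ)⌋₊

/-- The parameter of the defective coloring of iteration `i + 1`. The final legal coloring is
treated as one more iteration, in which the defective and the arbdefective coloring are legal. -/
noncomputable def defectParameter (ε : ℝ) (a p i : ℕ) : ℕ :=
  if i < loopLength ε a p then p else alpha ε a p i + 1

/-- The number of colors used in iteration `i + 1`. -/
noncomputable def numColors (ε : ℝ) (a p i : ℕ) : ℕ :=
  if i < loopLength ε a p then p else degreeBound ε a p i + 1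

/-- The variables of a vertex: the index of its subgraph before iteration `i + 1` and, in this
iteration, whether it is still active after `s` steps of the `H`-partition, its `H`-index, its color
on level `j` of the defective coloring (the result is the color on level `0`), and the color that
it selects. -/
inductive Variable
  | part (i : ℕ)
  | active (i s : ℕ)
  | index (i : ℕ)
  | level (i j : ℕ)
  | color (i : ℕ)

/-- The number of neighbours with property `Q`. -/
noncomputable def countNeighbors (N : ℕ → Option (Variable → ℕ)) (Q : (Variable → ℕ) → Prop) : ℕ :=
  {j | ∃ t, N j = some t ∧ Q t}.ncard

open Variable Classical in
/-- The rules of the algorithm. -/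
noncomputable def ruleValue (ε : ℝ) (x : ℕ × ℕ) (ident : ℕ) (f : Variable → ℕ)
    (N : ℕ → Option (Variable → ℕ)) : Variable → ℕ
  | part 0 => 1
  | part (i + 1) => (f (part i) - 1) * x.2 + f (color i)
  | active _ 0 => 1
  | active i (s + 1) =>
      if f (active i s) ≠ 0 ∧ degreeBound ε x.1 x.2 i <
        countNeighbors N (fun t => t (part i) = f (part i) ∧ t (active i s) ≠ 0) then 1 else 0
  | index i => sInf {s | f (active i s) = 0}
  | level i j =>
      let q := levelPrime (defectParameter ε x.1 x.2 i) j
      -- Small identities serve as colours themselves, shifted by `q ^ 2` past the reduced colours.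
      -- A vertex decides this from its own identity, without knowing `n`.
      if ident < 4 ^ j then q ^ 2 + ident else
        let b := argminBelow q (fun b => countNeighbors N (fun t =>
          (t (part i) = f (part i) ∧ t (index i) = f (index i) ∧
            t (level i (j + 1)) ≠ f (level i (j + 1))) ∧
            evalQuadratic q (t (level i (j + 1))) b = evalQuadratic q (f (level i (j + 1))) b))
        b * q + (evalQuadratic q (f (level i (j + 1))) b).val
  | color i => 1 + argminBelow (numColors ε x.1 x.2 i) (fun c => countNeighbors N (fun t =>
      t (part i) = f (part i) ∧
        (f (index i) < t (index i) ∨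
          (f (index i) = t (index i) ∧ f (level i 0) < t (level i 0))) ∧
        t (color i) = 1 + c))

open Variable in
/-- The implementation of Procedure Legal-Coloring. -/
noncomputable def rules (ε : ℝ) : LocalRules (ℕ × ℕ) Variable VertexRecord where
  value := ruleValue ε
  answer x f :=
    let m := loopLength ε x.1 x.2
    -- The default `0` beyond the loop makes the answer depend on finitely many variables, so that
    -- it can become determined.
    { hIndex := fun i => if i < m then f (index i) else 0
      defColor := fun i => if i < m then f (level i 0) + 1 else 0
      arbColor := fun i => if i < m then f (color i) else 0
      color := (f (part m) - 1) * (degreeBound ε x.1 x.2 m + 1) + f (color m) }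

lemma rules_value (ε : ℝ) : (rules ε).value = ruleValue ε := rfl

/-! ## What the vertices know -/

lemma countNeighbors_neighborTable {V : Type u} {G : SimpleGraph V} {ident : V → ℕ}
    (hid : Function.Injective ident) (g : V → Variable → ℕ) (v : V) (Q : (Variable → ℕ) → Prop) :
    countNeighbors (neighborTable G ident g v) Q = {w | G.Adj v w ∧ Q (g w)}.ncard :=
  ncard_neighborTable hid g v Q

/-- The least zero is decided by the values up to any one zero, so an index is known although
infinitely many `active` variables are not. -/
lemma sInf_zeros_congr {f f' : ℕ → ℕ} {L s₀ : ℕ} (h : ∀ s ≤ L, f s = f' s) (hs : s₀ ≤ L)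
    (h0 : f' s₀ = 0) : sInf {s | f s = 0} = sInf {s | f' s = 0} := by
  have h0' : f s₀ = 0 := (h s₀ hs).trans h0
  have m1 : f (sInf {s | f s = 0}) = 0 := Nat.sInf_mem (s := {s | f s = 0}) ⟨s₀, h0'⟩
  have m2 : f' (sInf {s | f' s = 0}) = 0 := Nat.sInf_mem (s := {s | f' s = 0}) ⟨s₀, h0⟩
  have l1 : sInf {s | f s = 0} ≤ s₀ := Nat.sInf_le h0'
  have l2 : sInf {s | f' s = 0} ≤ s₀ := Nat.sInf_le h0
  refine le_antisymm (Nat.sInf_le ?_) (Nat.sInf_le ?_)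
  · exact (h _ (l2.trans hs)).trans m2
  · exact (h _ (l1.trans hs)).symm.trans m1

section Knowledge

open Variable

variable {V : Type u} {ε : ℝ} {G : SimpleGraph V} {ident : V → ℕ} {a p : ℕ}

local notation "Kn" => LocalRules.Known (rules ε) G ident (a, p)
local notation "Val" => LocalRules.final (rules ε) G ident (a, p)

lemma known_part_zero (hid : Function.Injective ident) (v : V) : Kn 1 v (part 0) :=
  (rules ε).known_succ G ident (a, p) hid fun _ _ => rfl

lemma known_part_succ (hid : Function.Injective ident) {r i : ℕ} {v : V}
    (h1 : Kn r v (part i)) (h2 : Kn r v (color i)) : Kn (r + 1) v (part (i + 1)) := by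
  refine (rules ε).known_succ G ident (a, p) hid fun g hg => ?_
  simp only [rules_value, ruleValue, hg v _ h1, hg v _ h2]

lemma known_active (hid : Function.Injective ident) {r i : ℕ}
    (h : ∀ w, Kn r w (part i)) (s : ℕ) (v : V) : Kn (r + s + 1) v (active i s) := by
  induction s generalizing v with
  | zero => exact (rules ε).known_succ G ident (a, p) hid fun _ _ => rfl
  | succ s ih =>
    refine (rules ε).known_succ G ident (a, p) hid fun g hg => ?_
    have h1 := fun w => hg w _ ((h w).mono (by omega))
    have h2 := fun w => hg w _ (ih w)
    simp only [rules_value, ruleValue, countNeighbors_neighborTable hid, h1, h2]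

lemma known_index (hid : Function.Injective ident) {r i L : ℕ} {v : V}
    (h : ∀ s ≤ L, Kn r v (active i s)) (h0 : Val v (active i L) = 0) :
    Kn (r + 1) v (index i) := by
  refine (rules ε).known_succ G ident (a, p) hid fun g hg => ?_
  exact sInf_zeros_congr (fun s hs => hg v _ (h s hs)) le_rfl h0

/-- Knowledge descends from level `J`, where all identities are small and no neighbour is consulted.
No vertex needs to know `J`. -/
lemma known_level (hid : Function.Injective ident) {r i J : ℕ}
    (h1 : ∀ w, Kn r w (part i)) (h2 : ∀ w, Kn r w (index i)) (hJ : ∀ w, ident w < 4 ^ J)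
    (k j : ℕ) (hk : J ≤ j + k) (v : V) : Kn (r + k + 1) v (level i j) := by
  induction k generalizing j v with
  | zero =>
    have hv : ident v < 4 ^ j :=
      (hJ v).trans_le (Nat.pow_le_pow_right (by norm_num) hk)
    refine (rules ε).known_succ G ident (a, p) hid fun g hg => ?_
    simp only [rules_value, ruleValue, if_pos hv]
  | succ k ih =>
    refine (rules ε).known_succ G ident (a, p) hid fun g hg => ?_
    have e1 := fun w => hg w _ ((h1 w).mono (by omega))
    have e2 := fun w => hg w _ ((h2 w).mono (by omega))
    have e3 := fun w => hg w _ (ih (j + 1) (by omega) w)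
    simp only [rules_value, ruleValue, countNeighbors_neighborTable hid, e1, e2, e3]

lemma known_color_of_parents (hid : Function.Injective ident) {r i : ℕ} {v : V}
    (h1 : ∀ w, Kn r w (part i)) (h2 : ∀ w, Kn r w (index i)) (h3 : ∀ w, Kn r w (level i 0))
    (h4 : ∀ w, G.Adj v w → Val w (part i) = Val v (part i) →
      (Val v (index i) < Val w (index i) ∨
        (Val v (index i) = Val w (index i) ∧ Val v (level i 0) < Val w (level i 0))) →
      Kn r w (color i)) : Kn (r + 1) v (color i) := by
  refine (rules ε).known_succ G ident (a, p) hid fun g hg => ?_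
  have e1 := fun w => hg w _ (h1 w)
  have e2 := fun w => hg w _ (h2 w)
  have e3 := fun w => hg w _ (h3 w)
  simp only [rules_value, ruleValue, countNeighbors_neighborTable hid, e1, e2, e3]
  -- The colour of a neighbour enters the counts only if it is a parent, so the unknown colours do
  -- not matter.
  congr 2
  funext c
  congr 1
  ext w
  simp only [Set.mem_ofPred_eq]
  constructor
  · rintro ⟨q1, q2, q3, q4⟩
    exact ⟨q1, q2, q3, (hg w _ (h4 w q1 q2 q3)).symm.trans q4⟩
  · rintro ⟨q1, q2, q3, q4⟩
    exact ⟨q1, q2, q3, (hg w _ (h4 w q1 q2 q3)).trans q4⟩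

/-- The potential `(L - index) * (P + 1) + (P - level)` strictly drops from a vertex to its parents,
so it bounds the waiting time. -/
lemma known_color (hid : Function.Injective ident) {r i L P : ℕ}
    (h1 : ∀ w, Kn r w (part i)) (h2 : ∀ w, Kn r w (index i)) (h3 : ∀ w, Kn r w (level i 0))
    (hL : ∀ w, Val w (index i) ≤ L) (hP : ∀ w, Val w (level i 0) ≤ P) (v : V) :
    Kn (r + (L * (P + 1) + P) + 1) v (color i) := by
  have key : ∀ N v, (L - Val v (index i)) * (P + 1) + (P - Val v (level i 0)) ≤ N →
      Kn (r + N + 1) v (color i) := by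
    intro N
    induction N using Nat.strong_induction_on with
    | _ N ih =>
      intro v hv
      refine known_color_of_parents hid (fun w => (h1 w).mono (by omega))
        (fun w => (h2 w).mono (by omega)) (fun w => (h3 w).mono (by omega)) ?_
      intro w _ _ hw
      have hlt : (L - Val w (index i)) * (P + 1) + (P - Val w (level i 0)) < N := by
        refine lt_of_lt_of_le ?_ hv
        rcases hw with hw | ⟨hw, hw'⟩
        · have : L - Val w (index i) + 1 ≤ L - Val v (index i) := by have := hL w; omega
          calc _ < (L - Val w (index i) + 1) * (P + 1) := by rw [Nat.add_mul]; omega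
            _ ≤ (L - Val v (index i)) * (P + 1) := Nat.mul_le_mul_right _ this
            _ ≤ _ := Nat.le_add_right _ _
        · rw [hw]
          have := hP w
          omega
      exact (ih _ hlt w le_rfl).mono (by omega)
  refine key _ v ?_
  gcongr <;> omega

/-! ## The values of the variables -/

lemma final_part_zero (hid : Function.Injective ident) (v : V) : Val v (part 0) = 1 :=
  (known_part_zero hid v).final_eq_value

lemma final_part_succ {r i : ℕ} {v : V} (h : Kn r v (part (i + 1))) :
    Val v (part (i + 1)) = (Val v (part i) - 1) * p + Val v (color i) :=
  h.final_eq_value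

lemma final_active_zero {r i : ℕ} {v : V} (h : Kn r v (active i 0)) :
    Val v (active i 0) = 1 :=
  h.final_eq_value

lemma final_active_succ_ne_zero_iff (hid : Function.Injective ident) {r i s : ℕ} {v : V}
    (h : Kn r v (active i (s + 1))) :
    Val v (active i (s + 1)) ≠ 0 ↔ Val v (active i s) ≠ 0 ∧ degreeBound ε a p i <
      {w | G.Adj v w ∧ Val w (part i) = Val v (part i) ∧ Val w (active i s) ≠ 0}.ncard := by
  have := h.final_eq_value
  simp only [rules_value, ruleValue, countNeighbors_neighborTable hid] at this
  constructor
  · intro h'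
    by_contra hc
    exact h' (this.trans (if_neg hc))
  · intro h'
    have e := this.trans (if_pos h')
    rw [show Val v (active i (s + 1)) = 1 from e]
    exact one_ne_zero

lemma final_index {r i : ℕ} {v : V} (h : Kn r v (index i)) :
    Val v (index i) = sInf {s | Val v (active i s) = 0} :=
  h.final_eq_value

lemma final_level (hid : Function.Injective ident) {r i j : ℕ} {v : V}
    (h : Kn r v (level i j)) :
    Val v (level i j) =
      if ident v < 4 ^ j then levelPrime (defectParameter ε a p i) j ^ 2 + ident v else
        reduceColor (levelPrime (defectParameter ε a p i) j) (fun v w => G.Adj v w ∧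
          Val w (part i) = Val v (part i) ∧ Val w (index i) = Val v (index i))
          (fun w => Val w (level i (j + 1))) v := by
  have := h.final_eq_value
  simp only [rules_value, ruleValue, countNeighbors_neighborTable hid, and_assoc] at this
  simp only [reduceColor, and_assoc]
  exact this

lemma final_color (hid : Function.Injective ident) {r i : ℕ} {v : V}
    (h : Kn r v (color i)) :
    Val v (color i) = 1 + argminBelow (numColors ε a p i) (fun c => {w | G.Adj v w ∧
      Val w (part i) = Val v (part i) ∧ (Val v (index i) < Val w (index i) ∨
        (Val v (index i) = Val w (index i) ∧ Val v (level i 0) < Val w (level i 0))) ∧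
      Val w (color i) = 1 + c}.ncard) := by
  have := h.final_eq_value
  simp only [rules_value, ruleValue, countNeighbors_neighborTable hid] at this
  exact this

end Knowledge

/-! ## The defective coloring -/

lemma reduceColor_lt {V : Type u} {q : ℕ} (hq : q.Prime) (S : V → V → Prop) (c : V → ℕ) (v : V) :
    reduceColor q S c v < q ^ 2 := by
  have : NeZero q := ⟨hq.ne_zero⟩
  simp only [reduceColor]
  set f : ℕ → ℕ := fun b =>
    {w | (S v w ∧ c w ≠ c v) ∧ evalQuadratic q (c w) b = evalQuadratic q (c v) b}.ncard
  have h1 := (argminBelow_spec hq.pos f).1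
  have h2 := ZMod.val_lt (evalQuadratic q (c v) (argminBelow q f))
  calc _ < argminBelow q f * q + q := by omega
    _ = (argminBelow q f + 1) * q := by ring
    _ ≤ q * q := Nat.mul_le_mul_right _ h1
    _ = q ^ 2 := by ring

/-- A new colour encodes the evaluation point and the value there. Neighbours of equal new colour
had equal old colour or conflict at the point chosen by `v`, and of the latter there are at most `2
* D / q`. -/
lemma ncard_reduceColor_eq_le {V : Type u} [Finite V] {q : ℕ} (hq : q.Prime) {S : V → V → Prop}
    {c : V → ℕ} (hc : ∀ w, c w < q ^ 3) {D : ℕ} {v : V} (hD : {w | S v w}.ncard ≤ D) :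
    {w | S v w ∧ reduceColor q S c w = reduceColor q S c v}.ncard * q ≤
      {w | S v w ∧ c w = c v}.ncard * q + 2 * D := by
  have : NeZero q := ⟨hq.ne_zero⟩
  have h := argminBelow_evalQuadratic_mul_le hq {w | S v w ∧ c w ≠ c v} c (hc v)
    (fun w _ => hc w) (fun w hw => hw.2)
  have hS : {w | S v w ∧ c w ≠ c v}.ncard ≤ D :=
    (Set.ncard_le_ncard (fun w hw => hw.1) (Set.toFinite _)).trans hD
  set b := argminBelow q (fun b => {w | w ∈ {w | S v w ∧ c w ≠ c v} ∧
    evalQuadratic q (c w) b = evalQuadratic q (c v) b}.ncard) with hb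
  have hdiv : ∀ w, ∃ b', reduceColor q S c w = b' * q + (evalQuadratic q (c w) b').val :=
    fun w => ⟨_, rfl⟩
  have hv : reduceColor q S c v = b * q + (evalQuadratic q (c v) b).val := rfl
  have hsub : {w | S v w ∧ reduceColor q S c w = reduceColor q S c v} ⊆
      {w | S v w ∧ c w = c v} ∪ {w | w ∈ {w | S v w ∧ c w ≠ c v} ∧
        evalQuadratic q (c w) b = evalQuadratic q (c v) b} := by
    rintro w ⟨h1, h2⟩
    by_cases hw : c w = c v
    · exact Or.inl ⟨h1, hw⟩
    · refine Or.inr ⟨⟨h1, hw⟩, ?_⟩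
      obtain ⟨b', hb'⟩ := hdiv w
      rw [hb', hv] at h2
      have l1 := ZMod.val_lt (evalQuadratic q (c w) b')
      have l2 := ZMod.val_lt (evalQuadratic q (c v) b)
      have e1 : b' = b := by
        have := congrArg (· / q) h2
        simpa [Nat.add_comm _ (ZMod.val _), Nat.add_mul_div_right _ _ hq.pos,
          Nat.div_eq_of_lt l1, Nat.div_eq_of_lt l2] using this
      subst e1
      exact ZMod.val_injective q (Nat.add_left_cancel h2)
  have hle := (Set.ncard_le_ncard hsub (Set.toFinite _)).trans (Set.ncard_union_le _ _)
  calc _ ≤ _ := Nat.mul_le_mul_right q hle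
    _ ≤ _ := by
      rw [Nat.add_mul]
      exact Nat.add_le_add_left (h.trans (Nat.mul_le_mul_left 2 hS)) _

section Levels

variable {V : Type u} {S : V → V → Prop} {ident : V → ℕ} {t : ℕ} {c : ℕ → V → ℕ}

lemma level_lt (ht : 0 < t)
    (hc : ∀ j v, c j v = if ident v < 4 ^ j then levelPrime t j ^ 2 + ident v else
      reduceColor (levelPrime t j) S (c (j + 1)) v) (j : ℕ) (v : V) :
    c j v < levelPrime t j ^ 2 + 4 ^ j := by
  rw [hc]
  split_ifs with h
  · omega
  · exact (reduceColor_lt (levelPrime_spec ht j).1 _ _ _).trans_le (Nat.le_add_right _ _)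

/-- Step `j` adds at most `2 * D / q ≤ D / (10 * t * 2 ^ j)` to the defect, and these increments sum
to `D / (5 * t * 2 ^ j)` from level `j` upwards. -/
lemma level_defect [Finite V] (ht : 0 < t) (hid : Function.Injective ident) (hS : ∀ v, ¬ S v v)
    (hc : ∀ j v, c j v = if ident v < 4 ^ j then levelPrime t j ^ 2 + ident v else
      reduceColor (levelPrime t j) S (c (j + 1)) v)
    {D : ℕ} (hD : ∀ v, {w | S v w}.ncard ≤ D) {J : ℕ} (hJ : ∀ v, ident v < 4 ^ J)
    (k j : ℕ) (hk : J ≤ j + k) (v : V) :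
    5 * t * 2 ^ j * {w | S v w ∧ c j w = c j v}.ncard ≤ D := by
  -- A raw colour has defect `0`: raw colours are distinct, and reduced ones lie below `q ^ 2`.
  have hraw : ∀ j v, ident v < 4 ^ j → {w | S v w ∧ c j w = c j v}.ncard = 0 := by
    intro j v hv
    rw [Set.ncard_eq_zero (Set.toFinite _), Set.eq_empty_iff_forall_notMem]
    rintro w ⟨h1, h2⟩
    rw [hc j v, if_pos hv, hc j w] at h2
    split_ifs at h2 with hw
    · exact hS v (hid (Nat.add_left_cancel h2) ▸ h1)
    · have := reduceColor_lt (levelPrime_spec ht j).1 S (c (j + 1)) w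
      omega
  induction k generalizing j v with
  | zero =>
    rw [hraw j v ((hJ v).trans_le (Nat.pow_le_pow_right (by norm_num) hk))]
    exact Nat.zero_le _
  | succ k ih =>
    by_cases hv : ident v < 4 ^ j
    · rw [hraw j v hv]
      exact Nat.zero_le _
    · have ih' := ih (j + 1) (by omega) v
      obtain ⟨hq, hq', -⟩ := levelPrime_spec ht j
      set q := levelPrime t j with hqdef
      have hstep := ncard_reduceColor_eq_le hq (S := S) (c := c (j + 1)) (v := v)
        (fun w => (level_lt ht hc (j + 1) w).trans_le (levelPrime_palette_succ ht j)) (hD v)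
      have hle : {w | S v w ∧ c j w = c j v}.ncard ≤
          {w | S v w ∧ reduceColor q S (c (j + 1)) w = reduceColor q S (c (j + 1)) v}.ncard := by
        refine Set.ncard_le_ncard ?_ (Set.toFinite _)
        rintro w ⟨h1, h2⟩
        refine ⟨h1, ?_⟩
        rw [hc j v, if_neg hv, hc j w, ← hqdef] at h2
        split_ifs at h2 with hw
        · have := reduceColor_lt hq S (c (j + 1)) v
          omega
        · exact h2
      set x := {w | S v w ∧ c j w = c j v}.ncard
      set y := {w | S v w ∧ c (j + 1) w = c (j + 1) v}.ncard
      have h1 : x * q ≤ y * q + 2 * D := (Nat.mul_le_mul_right q hle).trans hstep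
      by_cases hxy : x ≤ y
      · refine le_trans ?_ ih'
        have h2j : 2 ^ j ≤ 2 ^ (j + 1) := Nat.pow_le_pow_right (by norm_num) (Nat.le_succ j)
        gcongr
      · obtain ⟨z, hz⟩ := Nat.exists_eq_add_of_le (le_of_not_ge hxy)
        have h2 : z * (20 * 2 ^ j * t) ≤ 2 * D := by
          refine (Nat.mul_le_mul_left z hq'.le).trans ?_
          rw [hz, Nat.add_mul] at h1
          omega
        -- Twice the claim splits into the inherited defect `y` and the new conflicts `z`, each
        -- contributing at most `D`.
        have h3 : 2 * (5 * t * 2 ^ j * x) = 5 * t * 2 ^ (j + 1) * y + z * (20 * 2 ^ j * t) / 2 := by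
          have : z * (20 * 2 ^ j * t) = 2 * (10 * (z * 2 ^ j * t)) := by ring
          rw [this, Nat.mul_div_cancel_left _ (by norm_num), hz]
          ring
        omega

end Levels

/-! ## One iteration -/

section Iteration

open Variable

variable {V : Type u} [Fintype V] {ε : ℝ} {G : SimpleGraph V} {ident : V → ℕ} {a p : ℕ}

local notation "Kn" => LocalRules.Known (rules ε) G ident (a, p)
local notation "Val" => LocalRules.final (rules ε) G ident (a, p)

-- A surviving vertex has more than `(2 + ε) α - 1` active neighbours in its part, while
-- orientability bounds the degree sum over the active set by `2 α` times its size.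
open Classical in
lemma card_active_succ_le (hid : Function.Injective ident) {r i : ℕ}
    (hpart : ∀ w, Kn r w (part i))
    (hE : OrientableWithin (fun v w => G.Adj v w ∧ Val w (part i) = Val v (part i))
      (alpha ε a p i)) (s : ℕ) :
    (2 + ε) * ((Finset.univ.filter (fun v => Val v (active i (s + 1)) ≠ 0)).card : ℝ) ≤
      2 * ((Finset.univ.filter (fun v => Val v (active i s) ≠ 0)).card : ℝ) := by
  have hact := fun v => final_active_succ_ne_zero_iff hid (known_active hid hpart (s + 1) v)
  have h := hE.card_mul_le (D := degreeBound ε a p i)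
    (S := Finset.univ.filter (fun v => Val v (active i s) ≠ 0))
    (S' := Finset.univ.filter (fun v => Val v (active i (s + 1)) ≠ 0))
    (Finset.monotone_filter_right _ fun v _ hv => ((hact v).1 hv).1) ?_
  · set x := (Finset.univ.filter (fun v => Val v (active i (s + 1)) ≠ 0)).card
    set y := (Finset.univ.filter (fun v => Val v (active i s) ≠ 0)).card
    have hD : (2 + ε) * (alpha ε a p i : ℝ) < degreeBound ε a p i + 1 := Nat.lt_floor_add_one _
    have h' : (x : ℝ) * (degreeBound ε a p i + 1) ≤ 2 * (alpha ε a p i) * y := by exact_mod_cast h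
    -- For `α = 0` nothing can be cancelled, but then no vertex survives.
    rcases Nat.eq_zero_or_pos (alpha ε a p i) with h0 | h0
    · have hx : x = 0 := by
        rw [h0, mul_zero, zero_mul] at h
        simpa using h
      rw [hx]
      simp
    · have h0' : (0 : ℝ) < alpha ε a p i := by exact_mod_cast h0
      have h1 : (x : ℝ) * ((2 + ε) * (alpha ε a p i : ℝ)) ≤ 2 * (alpha ε a p i) * y :=
        (mul_le_mul_of_nonneg_left hD.le (Nat.cast_nonneg x)).trans h'
      refine le_of_mul_le_mul_right ?_ h0'
      linarith
  · intro v hv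
    refine ((hact v).1 (Finset.mem_filter.1 hv).2).2.trans_eq ?_
    simp only [Finset.mem_filter, Finset.mem_univ, true_and, and_assoc]

lemma final_active_eq_zero (hε : 0 < ε) (hid : Function.Injective ident) {r i L : ℕ}
    (hpart : ∀ w, Kn r w (part i))
    (hE : OrientableWithin (fun v w => G.Adj v w ∧ Val w (part i) = Val v (part i))
      (alpha ε a p i)) (hL : (Fintype.card V : ℝ) * 2 ^ L < (2 + ε) ^ L) (v : V) :
    Val v (active i L) = 0 := by
  classical
  have hcard : ∀ s, (2 + ε) ^ s *
      ((Finset.univ.filter (fun v => Val v (active i s) ≠ 0)).card : ℝ) ≤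
      Fintype.card V * 2 ^ s := by
    intro s
    induction s with
    | zero =>
      simp only [pow_zero, one_mul, mul_one, Nat.cast_le]
      exact Finset.card_le_univ _
    | succ s ih =>
      have h := card_active_succ_le hid hpart hE s
      rw [pow_succ, mul_assoc, pow_succ]
      calc _ ≤ (2 + ε) ^ s * (2 *
            ((Finset.univ.filter (fun v => Val v (active i s) ≠ 0)).card : ℝ)) :=
            mul_le_mul_of_nonneg_left h (by positivity)
        _ ≤ _ := by linarith
  by_contra hv
  have hpos : 1 ≤ (Finset.univ.filter (fun v => Val v (active i L) ≠ 0)).card :=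
    Finset.card_pos.2 ⟨v, Finset.mem_filter.2 ⟨Finset.mem_univ v, hv⟩⟩
  have hpos' : (1 : ℝ) ≤ (Finset.univ.filter (fun v => Val v (active i L) ≠ 0)).card := by
    exact_mod_cast hpos
  have := le_mul_of_one_le_right (show 0 ≤ (2 + ε) ^ L by positivity) hpos'
  linarith [hcard L]

lemma degreeBound_le (hε : ε < 1 / 2) (i : ℕ) : degreeBound ε a p i ≤ 3 * alpha ε a p i := by
  refine Nat.floor_le_of_le ?_
  push_cast
  exact mul_le_mul_of_nonneg_right (by linarith) (Nat.cast_nonneg _)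

/-- The number of rounds of an iteration, for `H`-partitions with at most `L` sets, identities less
than `4 ^ J` and defective colorings with at most `P` colors. -/
def iterationTime (L J P : ℕ) : ℕ := L + 1 + 1 + (J + 1) + (L * (P + 1) + P) + 1 + 1

variable (ε G ident a p) in
/-- In `T` rounds after round `r` the vertices have carried out iteration `i + 1`. -/
structure IterationSpec (K : ℝ) (r i T : ℕ) : Prop where
  known_index : ∀ v, Kn (r + T) v (index i)
  known_level : ∀ v, Kn (r + T) v (level i 0)
  known_color : ∀ v, Kn (r + T) v (color i)
  known_part : ∀ v, Kn (r + T) v (part (i + 1))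
  run : IsParallelRun ε K (Fintype.card V) G (fun v => Val v (part i)) (alpha ε a p i)
    (numColors ε a p i) (defectParameter ε a p i) (fun v => Val v (index i))
    (fun v => Val v (level i 0) + 1) (fun v => Val v (color i))

lemma iterationSpec (hε0 : 0 < ε) (hε1 : ε < 1 / 2) (hid : Function.Injective ident) {r i L J : ℕ}
    (hpart : ∀ w, Kn r w (part i))
    (hE : OrientableWithin (fun v w => G.Adj v w ∧ Val w (part i) = Val v (part i))
      (alpha ε a p i)) (hL : (Fintype.card V : ℝ) * 2 ^ L < (2 + ε) ^ L)
    (hJ : ∀ w, ident w < 4 ^ J) (ht : 0 < defectParameter ε a p i) (hk : 0 < numColors ε a p i)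
    {K : ℝ} (hK : 1601 ≤ K) (hLK : (L : ℝ) ≤ K * Real.logb 2 (Fintype.card V)) {P : ℕ}
    (hP : 1601 * defectParameter ε a p i ^ 2 ≤ P) :
    IterationSpec ε G ident a p K r i (iterationTime L J P) := by
  set t := defectParameter ε a p i with htdef
  set D := degreeBound ε a p i with hDdef
  have h0 := final_active_eq_zero hε0 hid hpart hE hL
  have kact : ∀ s ≤ L, ∀ v, Kn (r + L + 1) v (active i s) := fun s hs v =>
    (known_active hid hpart s v).mono (by omega)
  have kind : ∀ v, Kn (r + L + 1 + 1) v (index i) := fun v =>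
    known_index hid (fun s hs => kact s hs v) (h0 v)
  have klev : ∀ j v, Kn (r + L + 1 + 1 + J + 1) v (level i j) := fun j v =>
    known_level hid (fun w => (hpart w).mono (by omega)) kind hJ J j (by omega) v
  have eind : ∀ v, Val v (index i) = sInf {s | Val v (active i s) = 0} := fun v =>
    final_index (kind v)
  have hne : ∀ v, ({s | Val v (active i s) = 0} : Set ℕ).Nonempty := fun v => ⟨L, h0 v⟩
  have indL : ∀ v, Val v (index i) ≤ L := fun v => by
    rw [eind]
    exact Nat.sInf_le (h0 v)
  have act_index : ∀ v, Val v (active i (Val v (index i))) = 0 := fun v => by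
    rw [eind]
    exact Nat.sInf_mem (hne v)
  have act_lt : ∀ v s, s < Val v (index i) → Val v (active i s) ≠ 0 := fun v s hs => by
    rw [eind] at hs
    exact Nat.notMem_of_lt_sInf (s := {s | Val v (active i s) = 0}) hs
  have ind1 : ∀ v, 1 ≤ Val v (index i) := fun v => by
    by_contra hc
    have h1 := act_index v
    rw [show Val v (index i) = 0 by omega,
      final_active_zero ((known_active hid hpart 0 v))] at h1
    exact one_ne_zero h1
  -- A vertex of index `s + 1` had at most `D` neighbours active after step `s`, and all neighbours
  -- of no smaller index were among them.
  have hdeg : ∀ v, {w | G.Adj v w ∧ Val w (part i) = Val v (part i) ∧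
      Val v (index i) ≤ Val w (index i)}.ncard ≤ D := by
    intro v
    obtain ⟨s, hs⟩ : ∃ s, Val v (index i) = s + 1 := Nat.exists_eq_succ_of_ne_zero (by
      have := ind1 v; omega)
    have h1 := act_index v
    rw [hs] at h1
    have h2 := mt (final_active_succ_ne_zero_iff hid (known_active hid hpart (s + 1) v)).2
      (not_not.2 h1)
    have h3 := not_lt.1 fun h => h2 ⟨act_lt v s (by omega), h⟩
    refine le_trans (Set.ncard_le_ncard ?_ (Set.toFinite _)) h3
    rintro w ⟨q1, q2, q3⟩
    exact ⟨q1, q2, act_lt w s (by omega)⟩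
  have elev := fun j v => final_level hid (klev j v)
  have levP : ∀ v, Val v (level i 0) + 1 ≤ 1601 * t ^ 2 := fun v => by
    have h1 := level_lt ht elev 0 v
    have h2 := levelPrime_palette ht 0
    simp only [pow_zero, mul_one] at h1 h2
    omega
  have kcol : ∀ v, Kn (r + L + 1 + 1 + J + 1 + (L * (P + 1) + P) + 1) v (color i) := fun v =>
    known_color hid (fun w => (hpart w).mono (by omega)) (fun w => (kind w).mono (by omega))
      (fun w => klev 0 w) indL (fun w => by have := levP w; omega) v
  have ecol := fun v => final_color hid (kcol v)
  have hspec := fun v => argminBelow_spec hk (fun c => {w | G.Adj v w ∧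
      Val w (part i) = Val v (part i) ∧ (Val v (index i) < Val w (index i) ∨
        (Val v (index i) = Val w (index i) ∧ Val v (level i 0) < Val w (level i 0))) ∧
      Val w (color i) = 1 + c}.ncard)
  have hT : r + iterationTime L J P =
      r + L + 1 + 1 + J + 1 + (L * (P + 1) + P) + 1 + 1 := by
    simp only [iterationTime]
    ring
  refine ⟨fun v => (kind v).mono (by omega), fun v => (klev 0 v).mono (by omega),
    fun v => (kcol v).mono (by omega), fun v => ?_, ind1, fun v => ?_, hdeg,
    fun v => Nat.le_add_left _ _, fun v => ?_, fun v => ?_, fun v => ?_, fun v => ?_,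
    fun v j hj1 hj2 => ?_⟩
  · rw [hT]
    exact known_part_succ hid ((hpart v).mono (by omega)) (kcol v)
  · exact le_trans (by exact_mod_cast indL v) hLK
  · calc ((Val v (level i 0) + 1 : ℕ) : ℝ) ≤ ((1601 * t ^ 2 : ℕ) : ℝ) := by
          exact_mod_cast levP v
      _ = 1601 * (t : ℝ) ^ 2 := by push_cast; ring
      _ ≤ K * (t : ℝ) ^ 2 := by gcongr
  -- From `5 * t * defect ≤ D ≤ 3 * α` follows `t * defect ≤ α`.
  · have hS : ∀ v, {w | G.Adj v w ∧ Val w (part i) = Val v (part i) ∧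
        Val w (index i) = Val v (index i)}.ncard ≤ D := by
      intro v
      refine le_trans (Set.ncard_le_ncard ?_ (Set.toFinite _)) (hdeg v)
      rintro w ⟨q1, q2, q3⟩
      exact ⟨q1, q2, q3.ge⟩
    have h1 := level_defect ht hid (fun v hv => hv.1.ne rfl) elev hS hJ J 0 (by omega) v
    have h2 := degreeBound_le (a := a) (p := p) hε1 i
    simp only [and_assoc, pow_zero, mul_one] at h1
    simp only [Nat.add_right_cancel_iff]
    rw [Nat.le_div_iff_mul_le ht, mul_comm]
    rw [mul_assoc] at h1
    omega
  · rw [ecol]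
    omega
  · have := (hspec v).1
    rw [ecol]
    omega
  · obtain ⟨j', rfl⟩ := Nat.exists_eq_add_of_le hj1
    have h1 := (hspec v).2 j' (by omega)
    simp only [← ecol v] at h1
    simpa only [Nat.add_lt_add_iff_right] using h1

end Iteration

/-! ## Arithmetic of the parameters -/

lemma alpha_succ (ε : ℝ) (a p i : ℕ) : alpha ε a p (i + 1) =
    ⌊(alpha ε a p i : ℝ) / p + (2 + ε) * (alpha ε a p i : ℝ) / p⌋₊ := rfl

/-- The integer divisions only round down, so their sum stays below the floor of the real sum. -/
lemma outdegree_le_alpha_succ {ε : ℝ} (hε : 0 < ε) {a p : ℕ} (i : ℕ) :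
    ⌊(2 + ε) * (alpha ε a p i : ℝ)⌋₊ / p + alpha ε a p i / p ≤ alpha ε a p (i + 1) := by
  rw [alpha_succ]
  refine Nat.le_floor ?_
  push_cast
  have h1 : ((⌊(2 + ε) * (alpha ε a p i : ℝ)⌋₊ / p : ℕ) : ℝ) ≤
      (2 + ε) * (alpha ε a p i : ℝ) / p := by
    refine Nat.cast_div_le.trans ?_
    gcongr
    exact Nat.floor_le (by positivity)
  have h2 : ((alpha ε a p i / p : ℕ) : ℝ) ≤ (alpha ε a p i : ℝ) / p := Nat.cast_div_le
  linarith

lemma alpha_mul_pow_le {ε : ℝ} (hε0 : 0 < ε) (hε : ε < 1 / 2) {a p : ℕ} (hp : 0 < p) (i : ℕ) :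
    (alpha ε a p i : ℝ) * (p : ℝ) ^ i ≤ 3.5 ^ i * a := by
  have hp' : (0 : ℝ) < p := by exact_mod_cast hp
  induction i with
  | zero => simp [alpha]
  | succ i ih =>
    have h1 : (alpha ε a p (i + 1) : ℝ) ≤
        (alpha ε a p i : ℝ) / p + (2 + ε) * (alpha ε a p i : ℝ) / p := by
      rw [alpha_succ]
      exact Nat.floor_le (by positivity)
    have h2 : (alpha ε a p (i + 1) : ℝ) * p ≤ 3.5 * alpha ε a p i := by
      calc _ ≤ ((alpha ε a p i : ℝ) / p + (2 + ε) * (alpha ε a p i : ℝ) / p) * p := by gcongr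
        _ = (3 + ε) * alpha ε a p i := by field_simp; ring
        _ ≤ _ := by gcongr; linarith
    calc _ = (alpha ε a p (i + 1) : ℝ) * p * p ^ i := by ring
      _ ≤ 3.5 * alpha ε a p i * p ^ i := by gcongr
      _ = 3.5 * (alpha ε a p i * p ^ i) := by ring
      _ ≤ 3.5 * (3.5 ^ i * a) := by gcongr
      _ = _ := by ring

/-- As `√p ≥ 4 > 3.5`, each iteration divides `α` by at least `√p ≥ a ^ (μ / 4)`; after `4 / μ` of
them `α ≤ 1`. -/
lemma alpha_le_of_le {ε μ : ℝ} (hε0 : 0 < ε) (hε : ε < 1 / 2) (hμ : 0 < μ) {a p : ℕ} (ha : 1 ≤ a)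
    (hp : 16 ≤ p) (hpa : (a : ℝ) ^ (μ / 2) ≤ p) {i : ℕ} (hi : 4 / μ ≤ i) :
    alpha ε a p i ≤ p := by
  have h := alpha_mul_pow_le hε0 hε (a := a) (p := p) (by omega) i
  have ha' : (1 : ℝ) ≤ a := by exact_mod_cast ha
  have hp' : (16 : ℝ) ≤ p := by exact_mod_cast hp
  set s := Real.sqrt p with hs
  have hs4 : 4 ≤ s := Real.le_sqrt_of_sq_le (by norm_num; exact hp)
  have hsp : (p : ℝ) = s * s := (Real.mul_self_sqrt (by positivity)).symm
  have h1 : (alpha ε a p i : ℝ) * s ^ i ≤ a := by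
    have hspos : 0 < s ^ i := by positivity
    refine le_of_mul_le_mul_right ?_ hspos
    calc (alpha ε a p i : ℝ) * s ^ i * s ^ i = alpha ε a p i * (p : ℝ) ^ i := by
          rw [hsp, mul_pow]; ring
      _ ≤ 3.5 ^ i * a := h
      _ ≤ s ^ i * a := by gcongr; linarith
      _ = a * s ^ i := mul_comm _ _
  have h2 : (a : ℝ) ^ (μ / 4) ≤ s := by
    rw [hs, Real.sqrt_eq_rpow]
    calc (a : ℝ) ^ (μ / 4) = ((a : ℝ) ^ (μ / 2)) ^ (1 / 2 : ℝ) := by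
          rw [← Real.rpow_mul (by positivity)]
          ring_nf
      _ ≤ _ := by gcongr
  have h3 : (a : ℝ) ≤ s ^ i := by
    calc (a : ℝ) = (a : ℝ) ^ (1 : ℝ) := (Real.rpow_one _).symm
      _ ≤ (a : ℝ) ^ (μ / 4 * i) := by
          refine Real.rpow_le_rpow_of_exponent_le ha' ?_
          rw [div_le_iff₀ hμ] at hi
          linarith
      _ = ((a : ℝ) ^ (μ / 4)) ^ i := by
          rw [Real.rpow_mul (by positivity), Real.rpow_natCast]
      _ ≤ s ^ i := by gcongr
  have h4 : (alpha ε a p i : ℝ) * a ≤ 1 * a :=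
    (mul_le_mul_of_nonneg_left h3 (by positivity)).trans (by linarith)
  have h5 : (alpha ε a p i : ℝ) ≤ 1 := le_of_mul_le_mul_right h4 (by linarith)
  have h6 : alpha ε a p i ≤ 1 := by exact_mod_cast h5
  omega

/-! ### Length of the loop, size of the palette, size of the parameters -/

section LoopLength

variable {ε μ : ℝ} {a p : ℕ}

lemma loopLength_of_lt (hp : p < 16) : loopLength ε a p = 0 := if_pos hp

lemma isLoopLength_loopLength (hε0 : 0 < ε) (hε : ε < 1 / 2) (hμ : 0 < μ) (ha : 1 ≤ a)
    (hpa : (a : ℝ) ^ (μ / 2) ≤ p) :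
    IsLoopLength ε a p (loopLength ε a p) ∧ loopLength ε a p ≤ ⌈4 / μ⌉₊ := by
  refine ⟨⟨fun hp => ?_, loopLength_of_lt⟩, ?_⟩
  · have hmem := alpha_le_of_le hε0 hε hμ ha hp hpa (Nat.le_ceil (4 / μ))
    rw [loopLength, if_neg (by omega)]
    refine ⟨fun i hi => ?_, ?_⟩
    · have := Nat.notMem_of_lt_sInf (s := {i | alpha ε a p i ≤ p}) hi
      exact not_le.1 this
    · exact Nat.sInf_mem (s := {i | alpha ε a p i ≤ p}) ⟨_, hmem⟩
  · rcases lt_or_ge p 16 with hp | hp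
    · rw [loopLength_of_lt hp]
      exact Nat.zero_le _
    · rw [loopLength, if_neg (by omega)]
      exact Nat.sInf_le (alpha_le_of_le hε0 hε hμ ha hp hpa (Nat.le_ceil (4 / μ)))

/-- Before the last iteration `α` still exceeded `p`, so `p ^ m` is at most `α * p ^ (m - 1) =
O(a)`. The last factor `3.5` is `2.5 + 1`. -/
lemma pow_mul_palette_le (hε0 : 0 < ε) (hε : ε < 1 / 2) (ha : 1 ≤ a) (hp : 0 < p) {m M : ℕ}
    (hm : IsLoopLength ε a p m) (hM : m ≤ M) :
    ((p ^ m * (⌊(2 + ε) * (alpha ε a p m : ℝ)⌋₊ + 1) : ℕ) : ℝ) ≤ 3.5 ^ (M + 1) * a := by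
  have ha' : (1 : ℝ) ≤ a := by exact_mod_cast ha
  have h1 := alpha_mul_pow_le hε0 hε (a := a) hp m
  have h2 : (p : ℝ) ^ m ≤ 3.5 ^ m * a := by
    cases m with
    | zero => simpa using ha'
    | succ m =>
      have h16 : 16 ≤ p := by
        by_contra hc
        exact absurd (hm.2 (by omega)) (Nat.succ_ne_zero m)
      have h3 : (p : ℝ) ≤ alpha ε a p m := by exact_mod_cast ((hm.1 h16).1 m (by omega)).le
      have h4 := alpha_mul_pow_le hε0 hε (a := a) hp m
      calc (p : ℝ) ^ (m + 1) = p * p ^ m := by ring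
        _ ≤ alpha ε a p m * p ^ m := by gcongr
        _ ≤ 3.5 ^ m * a := h4
        _ ≤ 3.5 ^ (m + 1) * a := by gcongr <;> [norm_num; omega]
  have h5 : (⌊(2 + ε) * (alpha ε a p m : ℝ)⌋₊ : ℝ) ≤ 2.5 * alpha ε a p m :=
    (Nat.floor_le (by positivity)).trans (by gcongr; linarith)
  push_cast
  calc (p : ℝ) ^ m * (⌊(2 + ε) * (alpha ε a p m : ℝ)⌋₊ + 1) ≤
      (p : ℝ) ^ m * (2.5 * alpha ε a p m + 1) := by gcongr
    _ = 2.5 * (alpha ε a p m * p ^ m) + p ^ m := by ring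
    _ ≤ 2.5 * (3.5 ^ m * a) + 3.5 ^ m * a := by gcongr
    _ = 3.5 ^ (m + 1) * a := by ring
    _ ≤ 3.5 ^ (M + 1) * a := by gcongr; norm_num

lemma defectParameter_le (i : ℕ) (hi : i ≤ loopLength ε a p) :
    defectParameter ε a p i ≤ max p (alpha ε a p (loopLength ε a p) + 1) := by
  unfold defectParameter
  split_ifs with h
  · exact le_max_left _ _
  · rw [le_antisymm hi (not_lt.1 h)]
    exact le_max_right _ _

/-- For `p < 16` the arboricity is bounded by `16 ^ (2 / μ)`; otherwise the loop ends with `α ≤ p <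
a ^ (μ / 2) + 1`. -/
lemma sq_max_le (hμ : 0 < μ) (ha : 1 ≤ a) (hp : p = ⌈(a : ℝ) ^ (μ / 2)⌉₊) {m : ℕ}
    (hm : IsLoopLength ε a p m) :
    ((max p (alpha ε a p m + 1) : ℕ) : ℝ) ^ 2 ≤ (17 + 16 ^ (2 / μ)) ^ 2 * (a : ℝ) ^ μ := by
  have ha' : (1 : ℝ) ≤ a := by exact_mod_cast ha
  set y := (a : ℝ) ^ (μ / 2) with hy
  have hy1 : 1 ≤ y := Real.one_le_rpow ha' (by positivity)
  have hyy : (a : ℝ) ^ μ = y ^ 2 := by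
    rw [hy, ← Real.rpow_natCast, ← Real.rpow_mul (by positivity)]
    norm_num
  have hpy : (p : ℝ) < y + 1 := hp ▸ Nat.ceil_lt_add_one (by positivity)
  have hyp : y ≤ p := hp ▸ Nat.le_ceil y
  have hpos : (0 : ℝ) < 16 ^ (2 / μ) := by positivity
  rw [hyy, ← mul_pow]
  refine pow_le_pow_left₀ (by positivity) ?_ 2
  rcases lt_or_ge p 16 with h16 | h16
  · have h16' : (p : ℝ) ≤ 16 := by exact_mod_cast h16.le
    have hα : alpha ε a p m = a := by rw [hm.2 h16]; rfl
    have hale : (a : ℝ) ≤ 16 ^ (2 / μ) := by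
      calc (a : ℝ) = y ^ (2 / μ) := by
            rw [hy, ← Real.rpow_mul (by positivity)]
            rw [show μ / 2 * (2 / μ) = 1 by field_simp, Real.rpow_one]
        _ ≤ _ := by gcongr; linarith
    have hmax : ((max p (alpha ε a p m + 1) : ℕ) : ℝ) ≤ 17 + 16 ^ (2 / μ) := by
      rw [hα]
      push_cast
      exact max_le (by linarith) (by linarith)
    exact hmax.trans (le_mul_of_one_le_right (by positivity) hy1)
  · have hα : (alpha ε a p m : ℝ) ≤ p := by exact_mod_cast (hm.1 h16).2
    have hmax : ((max p (alpha ε a p m + 1) : ℕ) : ℝ) ≤ 3 * y := by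
      push_cast
      exact max_le (by linarith) (by linarith)
    exact hmax.trans (by gcongr; linarith)

end LoopLength

/-- `L` is the logarithm of `n` to base `(2 + ε) / 2`, rounded up; `n ≥ 2` absorbs the rounding. -/
lemma exists_partition_length {ε : ℝ} (hε : 0 < ε) : ∃ c : ℝ, 0 < c ∧ ∀ n : ℕ, 2 ≤ n →
    ∃ L : ℕ, (n : ℝ) * 2 ^ L < (2 + ε) ^ L ∧ (L : ℝ) ≤ c * Real.logb 2 n := by
  have hb : 1 < (2 + ε) / 2 := by linarith
  set β := Real.logb 2 ((2 + ε) / 2) with hβ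
  have hβ0 : 0 < β := Real.logb_pos (by norm_num) hb
  refine ⟨1 / β + 1, by positivity, fun n hn => ?_⟩
  have hn' : (2 : ℝ) ≤ n := by exact_mod_cast hn
  have hl : 1 ≤ Real.logb 2 n := by
    rw [Real.le_logb_iff_rpow_le (by norm_num) (by linarith), Real.rpow_one]
    exact hn'
  refine ⟨⌊Real.logb 2 n / β⌋₊ + 1, ?_, ?_⟩
  · set L := ⌊Real.logb 2 n / β⌋₊ + 1 with hL
    have h1 : Real.logb 2 n / β < L := by
      rw [hL]
      push_cast
      exact Nat.lt_floor_add_one _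
    have h2 : Real.logb 2 n < Real.logb 2 (((2 + ε) / 2) ^ L) := by
      rw [Real.logb_pow, ← hβ]
      rwa [div_lt_iff₀ hβ0] at h1
    have h3 : (n : ℝ) < ((2 + ε) / 2) ^ L :=
      (Real.logb_lt_logb_iff (by norm_num) (by linarith) (by positivity)).1 h2
    rw [div_pow, lt_div_iff₀ (by positivity)] at h3
    exact h3
  · push_cast
    have h1 : (⌊Real.logb 2 n / β⌋₊ : ℝ) ≤ Real.logb 2 n / β := Nat.floor_le (by positivity)
    calc _ ≤ Real.logb 2 n / β + Real.logb 2 n := by linarith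
      _ = _ := by ring

lemma iterationTime_le {L J P : ℕ} {c c' A l : ℝ} (hA : 1 ≤ A) (hl : 1 ≤ l)
    (hL : (L : ℝ) ≤ c * l) (hJ : (J : ℝ) ≤ 2 * l) (hP : (P : ℝ) ≤ c' * A) :
    (iterationTime L J P : ℝ) ≤ (c * c' + 2 * c + c' + 7) * (A * l) := by
  have hc : 0 ≤ c := by
    by_contra h
    have h1 : c * l < 0 := mul_neg_of_neg_of_pos (not_le.1 h) (by linarith)
    linarith [Nat.cast_nonneg (α := ℝ) L]
  have hc' : 0 ≤ c' := by
    by_contra h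
    have h1 : c' * A < 0 := mul_neg_of_neg_of_pos (not_le.1 h) (by linarith)
    linarith [Nat.cast_nonneg (α := ℝ) P]
  have e : (iterationTime L J P : ℝ) = L * P + 2 * L + P + J + 5 := by
    simp only [iterationTime]
    push_cast
    ring
  have hAl : l ≤ A * l := le_mul_of_one_le_left (by linarith) hA
  have hAl' : A ≤ A * l := le_mul_of_one_le_right (by linarith) hl
  rw [e]
  calc (L : ℝ) * P + 2 * L + P + J + 5 ≤
        c * l * (c' * A) + 2 * (c * l) + c' * A + 2 * l + 5 * 1 := by
        rw [mul_one]
        gcongr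
    _ ≤ c * l * (c' * A) + 2 * (c * (A * l)) + c' * (A * l) + 2 * (A * l) + 5 * (A * l) := by
        gcongr
        linarith
    _ = _ := by ring

/-! ## Runs of Procedure Legal-Coloring -/

section Runs

variable {V : Type u} {ε K : ℝ} {G : SimpleGraph V} {p m : ℕ}

/-- The final iteration, with defect `0` and more colors than parents, yields a legal coloring. -/
lemma IsParallelRun.color_ne [Finite V] {n : ℕ} {φ : V → ℕ} {α k t : ℕ} {h d c : V → ℕ}
    (H : IsParallelRun ε K n G φ α k t h d c) (ht : α < t) (hk : ⌊(2 + ε) * α⌋₊ < k)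
    {v w : V} (hvw : G.Adj v w) (hφ : φ v = φ w) : c v ≠ c w := by
  have hpar : ∀ v w, G.Adj v w → φ v = φ w → (h v < h w ∨ (h v = h w ∧ d v < d w)) →
      c v ≠ c w := by
    intro v w hvw hφ hp hc
    have h1 := H.mul_ncard_parents_le v
    have h2 : 0 < {w | G.Adj v w ∧ φ w = φ v ∧ (h v < h w ∨ (h v = h w ∧ d v < d w)) ∧
        c w = c v}.ncard :=
      (Set.ncard_pos (Set.toFinite _)).2 ⟨w, hvw, hφ.symm, hp, hc.symm⟩
    have h3 := Nat.le_mul_of_pos_right k h2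
    omega
  rcases lt_trichotomy (h v) (h w) with hh | hh | hh
  · exact hpar v w hvw hφ (Or.inl hh)
  · rcases lt_trichotomy (d v) (d w) with hd | hd | hd
    · exact hpar v w hvw hφ (Or.inr ⟨hh, hd⟩)
    · have h1 := H.defect_le v
      rw [Nat.div_eq_of_lt ht] at h1
      have h2 : 0 < {w | G.Adj v w ∧ φ w = φ v ∧ h w = h v ∧ d w = d v}.ncard :=
        (Set.ncard_pos (Set.toFinite _)).2 ⟨w, hvw, hφ.symm, hh.symm, hd.symm⟩
      omega
    · exact (hpar w v hvw.symm hφ.symm (Or.inr ⟨hh.symm, hd⟩)).symm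
  · exact (hpar w v hvw.symm hφ.symm (Or.inl hh)).symm

lemma partIndex_succ (x : VertexRecord) (i : ℕ) :
    partIndex p x (i + 1) = (partIndex p x i - 1) * p + x.arbColor i := rfl

lemma partIndex_mem {x : VertexRecord} (h : ∀ i < m, 1 ≤ x.arbColor i ∧ x.arbColor i ≤ p)
    (i : ℕ) (hi : i ≤ m) : 1 ≤ partIndex p x i ∧ partIndex p x i ≤ p ^ i := by
  induction i with
  | zero => simp [partIndex]
  | succ i ih =>
    obtain ⟨h1, h2⟩ := ih (by omega)
    obtain ⟨h3, h4⟩ := h i (by omega)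
    rw [partIndex_succ, pow_succ]
    obtain ⟨k, hk⟩ := Nat.exists_eq_add_of_le h1
    rw [hk] at h2 ⊢
    have h5 := Nat.mul_le_mul_right p h2
    rw [Nat.add_mul] at h5
    rw [Nat.add_sub_cancel_left]
    omega

/-- Uniqueness of digits in base `p`, with digits `1, …, p`: a new index determines the old one and
the colour. -/
lemma eq_of_sub_one_mul_add_eq {x y c d : ℕ} (hx : 1 ≤ x) (hy : 1 ≤ y)
    (hc : 1 ≤ c) (hcp : c ≤ p) (hd : 1 ≤ d) (hdp : d ≤ p)
    (h : (x - 1) * p + c = (y - 1) * p + d) : x = y ∧ c = d := by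
  have key : ∀ {x y c d : ℕ}, 1 ≤ c → d ≤ p → x < y →
      (x - 1) * p + d < (y - 1) * p + c ∨ x = 0 := by
    intro x y c d hc hd hxy
    rcases Nat.eq_zero_or_pos x with h0 | h0
    · exact Or.inr h0
    · left
      have h1 : x - 1 + 1 ≤ y - 1 := by omega
      have h2 := Nat.mul_le_mul_right p h1
      rw [Nat.add_mul] at h2
      omega
  rcases lt_trichotomy x y with hxy | rfl | hxy
  · have := key hd hcp hxy
    omega
  · exact ⟨rfl, by omega⟩
  · have := key hc hdp hxy
    omega

/-- What holds for every run of Procedure Legal-Coloring. -/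
lemma IsLegalColoringRun.spec [Fintype V] {ρ : V → VertexRecord} (hε : 0 < ε) (hp : 0 < p)
    (H : IsLegalColoringRun ε K G p m ρ) :
    (∀ i, i < m → ∀ g, IsArbdefectiveColoring
        (colorClass G (fun v => partIndex p (ρ v) i) g)
        (fun v => (ρ v).arbColor i) (alpha ε (arboricity G) p (i + 1)) p) ∧
      IsLegalColoring G (fun v => (ρ v).color) ∧
      ∀ v, 1 ≤ (ρ v).color ∧ (ρ v).color ≤
        p ^ m * (⌊(2 + ε) * (alpha ε (arboricity G) p m : ℝ)⌋₊ + 1) := by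
  obtain ⟨H1, H2⟩ := H
  have H1' : ∀ i, i < m → IsParallelRun ε K (Fintype.card V) G (fun v => partIndex p (ρ v) i)
      (alpha ε (arboricity G) p i) p p (fun v => (ρ v).hIndex i) (fun v => (ρ v).defColor i)
      (fun v => (ρ v).arbColor i) := fun i hi =>
    forall_isArbdefectiveColoringRun_iff.1 (H1 i hi)
  have hpart : ∀ v, 1 ≤ partIndex p (ρ v) m ∧ partIndex p (ρ v) m ≤ p ^ m := fun v =>
    partIndex_mem (fun i hi => ⟨(H1' i hi).one_le_color v, (H1' i hi).color_le v⟩) m le_rfl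
  set A := ⌊(2 + ε) * (alpha ε (arboricity G) p m : ℝ)⌋₊ + 1 with hA
  have hcol : ∀ v, (partIndex p (ρ v) m - 1) * A + 1 ≤ (ρ v).color ∧
      (ρ v).color ≤ partIndex p (ρ v) m * A := fun v => (H2 _).2 v rfl
  refine ⟨fun i hi g => ⟨fun v => ⟨(H1' i hi).one_le_color v, (H1' i hi).color_le v⟩,
    fun j _ _ => ((H1' i hi).arboricity_le hp g j).trans (outdegree_le_alpha_succ hε i)⟩,
    fun v w hvw => ?_, fun v => ⟨le_trans (Nat.le_add_left _ _) (hcol v).1,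
      (hcol v).2.trans (Nat.mul_le_mul_right _ (hpart v).2)⟩⟩
  -- Distinct parts have disjoint palettes, in the order of their indices.
  have hlt : ∀ v w, partIndex p (ρ v) m < partIndex p (ρ w) m → (ρ v).color < (ρ w).color := by
    intro v w h
    have h1 : partIndex p (ρ v) m ≤ partIndex p (ρ w) m - 1 := by omega
    have h2 := Nat.mul_le_mul_right A h1
    have h3 := (hcol v).2
    have h4 := (hcol w).1
    omega
  rcases lt_trichotomy (partIndex p (ρ v) m) (partIndex p (ρ w) m) with h | h | h
  · exact (hlt v w h).ne
  · exact (H2 (partIndex p (ρ w) m)).1 ⟨v, h⟩ ⟨w, rfl⟩ hvw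
  · exact (hlt w v h).ne'

end Runs

/-! ### The algorithm carries out a run -/

section Implementation

open Variable

variable {V : Type u} [Fintype V] {ε K : ℝ} {G : SimpleGraph V} {ident : V → ℕ} {a p : ℕ}

local notation "Kn" => LocalRules.Known (rules ε) G ident (a, p)
local notation "Val" => LocalRules.final (rules ε) G ident (a, p)

lemma numColors_pos (hp : 0 < p) (i : ℕ) : 0 < numColors ε a p i := by
  unfold numColors
  split_ifs
  · exact hp
  · exact Nat.succ_pos _

lemma defectParameter_pos (hp : 0 < p) (i : ℕ) : 0 < defectParameter ε a p i := by
  unfold defectParameter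
  split_ifs
  · exact hp
  · exact Nat.succ_pos _

/-- The invariant is orientability of the edges inside parts, which handles all subgraphs together.
Part indices at least `1` keep the truncated subtraction in the indexing faithful. -/
lemma iterations (hε0 : 0 < ε) (hε1 : ε < 1 / 2) (hid : Function.Injective ident)
    (ha : a = arboricity G) (hp : 0 < p) {L J P : ℕ}
    (hL : (Fintype.card V : ℝ) * 2 ^ L < (2 + ε) ^ L)
    (hJ : ∀ w, ident w < 4 ^ J) (hK : 1601 ≤ K)
    (hLK : (L : ℝ) ≤ K * Real.logb 2 (Fintype.card V))
    (hP : ∀ i ≤ loopLength ε a p, 1601 * defectParameter ε a p i ^ 2 ≤ P)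
    (i : ℕ) (hi : i ≤ loopLength ε a p) :
    IterationSpec ε G ident a p K (1 + i * iterationTime L J P) i (iterationTime L J P) ∧
      ∀ w, 1 ≤ Val w (part i) := by
  suffices h : ((∀ w, Kn (1 + i * iterationTime L J P) w (part i)) ∧
      OrientableWithin (fun v w => G.Adj v w ∧ Val w (part i) = Val v (part i))
        (alpha ε a p i)) ∧ ∀ w, 1 ≤ Val w (part i) from
    ⟨iterationSpec hε0 hε1 hid h.1.1 h.1.2 hL hJ (defectParameter_pos hp i) (numColors_pos hp i)
      hK hLK (hP i hi), h.2⟩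
  induction i with
  | zero =>
    refine ⟨⟨fun w => (known_part_zero hid w).mono (by omega), ?_⟩,
      fun w => (final_part_zero hid w).ge⟩
    obtain ⟨O, h1, h2⟩ := orientableWithin_arboricity G
    exact ⟨O, fun v w hvw => h1 v w hvw.1, fun v => (h2 v).trans_eq ha.symm⟩
  | succ i ih =>
    obtain ⟨⟨h1, h2⟩, h3⟩ := ih (by omega)
    have S := iterationSpec hε0 hε1 hid h1 h2 hL hJ (defectParameter_pos hp i)
      (numColors_pos hp i) hK hLK (hP i (by omega))
    have hi' : i < loopLength ε a p := hi
    have hrun := S.run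
    rw [numColors, defectParameter, if_pos hi', if_pos hi'] at hrun
    have hpart := fun v => final_part_succ (S.known_part v)
    refine ⟨⟨fun w => (S.known_part w).mono (by rw [Nat.add_mul]; omega), ?_⟩, fun w => ?_⟩
    · obtain ⟨O, q1, q2⟩ := hrun.orientableWithin hp (ψ := fun v => Val v (part (i + 1)))
        (fun v w hvw => eq_of_sub_one_mul_add_eq (h3 w) (h3 v) (hrun.one_le_color w)
          (hrun.color_le w) (hrun.one_le_color v) (hrun.color_le v) (by
            rw [← hpart w, ← hpart v]; exact hvw))
      exact ⟨O, q1, fun v => (q2 v).trans (outdegree_le_alpha_succ hε0 i)⟩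
    · rw [hpart]
      exact (hrun.one_le_color w).trans (Nat.le_add_left _ _)

/-- The algorithm carries out a run of Procedure Legal-Coloring. -/
lemma implementation (hε0 : 0 < ε) (hε1 : ε < 1 / 2) (hid : Function.Injective ident)
    (ha : a = arboricity G) (hp : 0 < p) {L J P : ℕ}
    (hL : (Fintype.card V : ℝ) * 2 ^ L < (2 + ε) ^ L)
    (hJ : ∀ w, ident w < 4 ^ J) (hK : 1601 ≤ K)
    (hLK : (L : ℝ) ≤ K * Real.logb 2 (Fintype.card V))
    (hP : ∀ i ≤ loopLength ε a p, 1601 * defectParameter ε a p i ^ 2 ≤ P) :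
    IsLegalColoringRun ε K G p (loopLength ε a p) (fun v => (rules ε).answer (a, p) (Val v)) ∧
      (rules ε).toAlgorithm.ComputesWithin G ident (a, p)
        (1 + (loopLength ε a p + 1) * iterationTime L J P)
        (fun v => (rules ε).answer (a, p) (Val v)) := by
  have S := fun i hi => (iterations hε0 hε1 hid ha hp hL hJ hK hLK hP i hi).1
  have S1 := fun i hi => (iterations hε0 hε1 hid ha hp hL hJ hK hLK hP i hi).2
  set τ := iterationTime L J P
  set m := loopLength ε a p with hm
  have hpart : ∀ i, i ≤ m → ∀ v, partIndex p ((rules ε).answer (a, p) (Val v)) i =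
      Val v (part i) := by
    intro i hi v
    induction i with
    | zero => exact (final_part_zero hid v).symm
    | succ i ih =>
      rw [partIndex_succ, ih (by omega), final_part_succ ((S i (by omega)).known_part v)]
      congr 1
      exact if_pos hi
  have hτ : ∀ i ≤ m, 1 + i * τ + τ ≤ 1 + (m + 1) * τ := fun i hi => by
    have := Nat.mul_le_mul_right τ (Nat.succ_le_succ hi)
    rw [Nat.succ_mul, Nat.succ_mul] at this
    rw [Nat.add_mul]
    omega
  refine ⟨⟨fun i hi => ?_, fun g => ⟨?_, ?_⟩⟩, ?_⟩
  · refine (forall_isArbdefectiveColoringRun_iff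
      (φ := fun v => partIndex p ((rules ε).answer (a, p) (Val v)) i)
      (h := fun v => ((rules ε).answer (a, p) (Val v)).hIndex i)
      (d := fun v => ((rules ε).answer (a, p) (Val v)).defColor i)
      (c := fun v => ((rules ε).answer (a, p) (Val v)).arbColor i)).2 ?_
    have hrun := (S i hi.le).run
    rw [numColors, defectParameter, if_pos hi, if_pos hi, ha] at hrun
    have e1 : ∀ v, ((rules ε).answer (a, p) (Val v)).hIndex i = Val v (index i) :=
      fun v => if_pos hi
    have e2 : ∀ v, ((rules ε).answer (a, p) (Val v)).defColor i = Val v (level i 0) + 1 :=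
      fun v => if_pos hi
    have e3 : ∀ v, ((rules ε).answer (a, p) (Val v)).arbColor i = Val v (color i) :=
      fun v => if_pos hi
    simp only [hpart i hi.le, e1, e2, e3]
    subst ha
    exact hrun
  · rintro ⟨v, hv⟩ ⟨w, hw⟩ hvw
    have hv' : Val v (part m) = g := (hpart m le_rfl v).symm.trans hv
    have hw' : Val w (part m) = g := (hpart m le_rfl w).symm.trans hw
    -- In iteration `m + 1` the parameters are `α + 1` and `degreeBound + 1`, so no defect remains
    -- and some colour is free.
    have hne := (S m le_rfl).run.color_ne (by simp [defectParameter, hm])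
      (by simp [numColors, degreeBound, hm]) hvw (hv'.trans hw'.symm)
    intro he
    refine hne ?_
    have he' : (Val v (part m) - 1) * (degreeBound ε a p m + 1) + Val v (color m) =
      (Val w (part m) - 1) * (degreeBound ε a p m + 1) + Val w (color m) := he
    rw [hv', hw'] at he'
    exact Nat.add_left_cancel he'
  · intro v hv
    have hv' : Val v (part m) = g := (hpart m le_rfl v).symm.trans hv
    have hg : 1 ≤ g := hv' ▸ S1 m le_rfl v
    have hrun := (S m le_rfl).run
    have h1 : 1 ≤ Val v (color m) := hrun.one_le_color v
    have h2 : Val v (color m) ≤ degreeBound ε a p m + 1 := by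
      refine (hrun.color_le v).trans_eq ?_
      simp [numColors, hm]
    have e : ((rules ε).answer (a, p) (Val v)).color =
      (Val v (part m) - 1) * (degreeBound ε a p m + 1) + Val v (color m) := rfl
    rw [e, hv', ← ha]
    change (g - 1) * (degreeBound ε a p m + 1) + 1 ≤ _ ∧ _ ≤ g * (degreeBound ε a p m + 1)
    obtain ⟨g', rfl⟩ := Nat.exists_eq_add_of_le' hg
    rw [Nat.add_sub_cancel, Nat.add_mul g' 1]
    omega
  · refine (rules ε).computesWithin G ident (a, p) fun v f hf => ?_
    have e1 : f (part m) = Val v (part m) := by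
      refine hf _ ?_
      rcases Nat.eq_zero_or_pos m with h0 | h0
      · rw [h0]
        exact (known_part_zero hid v).mono (by omega)
      · obtain ⟨i, hi⟩ := Nat.exists_eq_succ_of_ne_zero h0.ne'
        have := ((S i (by omega)).known_part v).mono (hτ i (by omega))
        rwa [show part m = part (i + 1) by rw [hi]]
    have e2 : ∀ i ≤ m, f (color i) = Val v (color i) := fun i hi =>
      hf _ (((S i hi).known_color v).mono (hτ i hi))
    have e3 : ∀ i ≤ m, f (index i) = Val v (index i) := fun i hi =>
      hf _ (((S i hi).known_index v).mono (hτ i hi))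
    have e4 : ∀ i ≤ m, f (level i 0) = Val v (level i 0) := fun i hi =>
      hf _ (((S i hi).known_level v).mono (hτ i hi))
    simp only [rules, ← hm, VertexRecord.mk.injEq]
    refine ⟨?_, ?_, ?_, ?_⟩
    · funext i
      split_ifs with hi
      · exact e3 i hi.le
      · rfl
    · funext i
      split_ifs with hi
      · exact congrArg (· + 1) (e4 i hi.le)
      · rfl
    · funext i
      split_ifs with hi
      · exact e2 i hi.le
      · rfl
    · rw [e1, e2 m le_rfl]
      rfl

end Implementation

end LegalColoring

/-! ### The theorem: choice of the constants -/

theorem mainTheorem1 (ε : ℝ) (hε0 : 0 < ε) (hε1 : ε < 1 / 2) :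
    ∃ (K : ℝ) (A : LegalColoring.LocalAlgorithm (ℕ × ℕ) LegalColoring.VertexRecord),
      ∀ μ : ℝ, 0 < μ → μ < 1 → ∃ C : ℝ, 0 < C ∧
        ∀ (V : Type u) [Fintype V] (G : SimpleGraph V) (ident : V → ℕ) (a p : ℕ),
          Function.Injective ident →
          (∀ v, 1 ≤ ident v ∧ ident v ≤ Fintype.card V) →
          a = LegalColoring.arboricity G → 1 ≤ a →
          p = ⌈(a : ℝ) ^ (μ / 2)⌉₊ →
          ∃ m : ℕ, LegalColoring.IsLoopLength ε a p m ∧ (m : ℝ) ≤ C ∧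
            -- every run of the procedure ends with a legal `O(a)`-coloring
            (∀ ρ : V → LegalColoring.VertexRecord,
              LegalColoring.IsLegalColoringRun ε K G p m ρ →
                (∀ i, i < m → ∀ g, LegalColoring.IsArbdefectiveColoring
                  (LegalColoring.colorClass G (fun v => LegalColoring.partIndex p (ρ v) i) g)
                  (fun v => (ρ v).arbColor i) (LegalColoring.alpha ε a p (i + 1)) p) ∧
                LegalColoring.IsLegalColoring G (fun v => (ρ v).color) ∧
                ∀ v, 1 ≤ (ρ v).color ∧ ((ρ v).color : ℝ) ≤ C * a) ∧
            -- and `A` carries out such a run in `O(a ^ μ * log n)` rounds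
            ∃ (ρ : V → LegalColoring.VertexRecord) (T : ℕ),
              LegalColoring.IsLegalColoringRun ε K G p m ρ ∧
              A.ComputesWithin G ident (a, p) T ρ ∧
              (T : ℝ) ≤ C * (a : ℝ) ^ μ * Real.logb 2 (Fintype.card V) := by
  obtain ⟨c, hc, hcL⟩ := LegalColoring.exists_partition_length hε0
  -- `1601` pays for the defective colours and `c` for the number of `H`-sets.
  refine ⟨1601 + c, (LegalColoring.rules ε).toAlgorithm, fun μ hμ _ => ?_⟩
  set M := ⌈4 / μ⌉₊ with hM
  set c' : ℝ := 1602 * (17 + 16 ^ (2 / μ)) ^ 2 with hc'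
  have hc'0 : 0 < c' := by positivity
  set C₁ : ℝ := 3.5 ^ (M + 1) with hC₁
  set C₂ : ℝ := 1 + (M + 1) * (c * c' + 2 * c + c' + 7) with hC₂
  have hC₁0 : 0 < C₁ := by positivity
  have hC₂0 : 0 < C₂ := by positivity
  -- The summands bound the iterations, the colours and the rounds.
  refine ⟨M + C₁ + C₂, by positivity, ?_⟩
  intro V _ G ident a p hid hids ha ha1 hp
  have ha1' : (1 : ℝ) ≤ a := by exact_mod_cast ha1
  have hpa : (a : ℝ) ^ (μ / 2) ≤ p := hp ▸ Nat.le_ceil _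
  have hp0 : 0 < p := by
    have : (0 : ℝ) < p := lt_of_lt_of_le (by positivity) hpa
    exact_mod_cast this
  obtain ⟨hm, hmM⟩ := LegalColoring.isLoopLength_loopLength hε0 hε1 hμ ha1 hpa
  set m := LegalColoring.loopLength ε a p with hmdef
  have hmM' : (m : ℝ) ≤ M := by exact_mod_cast hmM
  refine ⟨m, hm, by linarith, fun ρ hρ => ?_, ?_⟩
  · obtain ⟨h1, h2, h3⟩ := hρ.spec hε0 hp0
    rw [← ha] at h1 h3
    refine ⟨h1, h2, fun v => ⟨(h3 v).1, ?_⟩⟩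
    have h4 := LegalColoring.pow_mul_palette_le hε0 hε1 ha1 hp0 hm hmM
    calc ((ρ v).color : ℝ) ≤ ((p ^ m * (⌊(2 + ε) *
          (LegalColoring.alpha ε a p m : ℝ)⌋₊ + 1) : ℕ) : ℝ) := by exact_mod_cast (h3 v).2
      _ ≤ C₁ * a := h4
      _ ≤ _ := by
        gcongr
        have : (0 : ℝ) ≤ M := Nat.cast_nonneg M
        linarith
  -- A graph on at most one vertex has arboricity `0`. Hence `log n ≥ 1`, which absorbs additive
  -- constants.
  · have hn : 2 ≤ Fintype.card V := by
      by_contra hlt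
      have hsub : Subsingleton V := Fintype.card_le_one_iff_subsingleton.1 (by omega)
      have h0 : LegalColoring.arboricity G ≤ 0 :=
        LegalColoring.arboricity_le_of_rank ident hid fun v => by
          rw [Nat.le_zero, Set.ncard_eq_zero (Set.toFinite _), Set.eq_empty_iff_forall_notMem]
          rintro w ⟨hw, -⟩
          exact hw.ne (Subsingleton.elim v w)
      omega
    set n := Fintype.card V with hndef
    have hn' : (2 : ℝ) ≤ n := by exact_mod_cast hn
    set l := Real.logb 2 n with hl
    have hl1 : 1 ≤ l := by
      rw [hl, Real.le_logb_iff_rpow_le (by norm_num) (by linarith), Real.rpow_one]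
      exact hn'
    obtain ⟨L, hL, hLc⟩ := hcL n hn
    set J := Nat.log 2 n + 1 with hJdef
    have hJ : ∀ w, ident w < 4 ^ J := fun w =>
      calc ident w ≤ n := (hids w).2
        _ < 2 ^ J := Nat.lt_pow_succ_log_self (by norm_num) n
        _ ≤ 4 ^ J := Nat.pow_le_pow_left (by norm_num) J
    have hJl : (J : ℝ) ≤ 2 * l := by
      have : (Nat.log 2 n : ℝ) ≤ l := Real.natLog_le_logb n 2
      rw [hJdef]
      push_cast
      linarith
    set t := max p (LegalColoring.alpha ε a p m + 1) with ht
    have hP : ∀ i ≤ m, 1601 * LegalColoring.defectParameter ε a p i ^ 2 ≤ 1601 * t ^ 2 :=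
      fun i hi => Nat.mul_le_mul_left _
        (Nat.pow_le_pow_left (LegalColoring.defectParameter_le i hi) 2)
    have hPc : ((1601 * t ^ 2 : ℕ) : ℝ) ≤ c' * (a : ℝ) ^ μ := by
      have := LegalColoring.sq_max_le hμ ha1 hp hm
      rw [hc', mul_assoc, Nat.cast_mul, Nat.cast_pow]
      exact mul_le_mul (by norm_num) this (by positivity) (by norm_num)
    have hA : 1 ≤ (a : ℝ) ^ μ := Real.one_le_rpow ha1' hμ.le
    have hLK : (L : ℝ) ≤ (1601 + c) * Real.logb 2 n :=
      hLc.trans (mul_le_mul_of_nonneg_right (by linarith) (by linarith))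
    obtain ⟨h1, h2⟩ := LegalColoring.implementation hε0 hε1 hid ha hp0 hL hJ (by linarith) hLK hP
    refine ⟨_, _, h1, h2, ?_⟩
    have hτ := LegalColoring.iterationTime_le hA hl1 hLc hJl hPc
    have hAl : 1 ≤ (a : ℝ) ^ μ * l := one_le_mul_of_one_le_of_one_le hA hl1
    push_cast at hτ ⊢
    calc _ ≤ 1 * ((a : ℝ) ^ μ * l) +
          (M + 1) * ((c * c' + 2 * c + c' + 7) * ((a : ℝ) ^ μ * l)) := by
          gcongr
          · rw [one_mul]
            exact hAl
      _ = C₂ * ((a : ℝ) ^ μ * l) := by rw [hC₂]; ring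
      _ ≤ (M + C₁ + C₂) * ((a : ℝ) ^ μ * l) := by
          gcongr
          have : (0 : ℝ) ≤ M := Nat.cast_nonneg M
          linarith
      _ = _ := by ring
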